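/- Let $\mathscr S$ be an essentially small triangulated category with shift $[1]$. For full subcategories $\mathscr X,\mathscr Y$, let $\mathscr X*\mathscr Y$ be the full subcategory of all $Z$ that fit in a triangle $X\to Z\to Y\to X[1]$ with $X\in\mathscr X$, $Y\in\mathscr Y$. A *good metric* on $\mathscr S$ is a sequence $\mathscr M=\{\mathscr M_n\}_{n\in\mathbb N}$ of full subcategories containing $0$ with $\mathscr M_n*\mathscr M_n=\mathscr M_n$ and $\mathscr M_{n+1}[-1]\cup\mathscr M_{n+1}\cup\mathscr M_{n+1}[1]\subseteq\mathscr M_n$ for all $n$. A sequence $X_0\to X_1\to X_2\to\cdots$ in $\mathscr S$ is *Cauchy* if for every $i$ the cones of all but finitely many of its maps $X_j\to X_{j+1}$ lie in $\mathscr M_i$. Let $\mathscr S\text{-Mod}$ be the category of additive functors from $\mathscr S^{\rm op}$ to abelian groups, $\mathfrak y:\mathscr S\to\mathscr S\text{-Mod}$, $X\mapsto{\rm Hom}_{\mathscr S}(-,X)$, the Yoneda functor, and $\Sigma$ the automorphism $\Sigma(F)(X)=F(X[-1])$. For a full subcategory $\mathscr A\subseteq\mathscr S$ let $\mathfrak L(\mathscr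 A)$ consist of the functors isomorphic to ${\rm colim}\,\mathfrak y(X_n)$ for a Cauchy sequence $\{X_n\}$ with all $X_n\in\mathscr A$; let $\mathfrak C(\mathscr S)$ consist of the functors $F$ with $F(\mathscr M_j)=0$ for some $j$; and let $\mathfrak S(\mathscr A)=\mathfrak L(\mathscr A)\cap\mathfrak C(\mathscr S)$, full subcategories of $\mathscr S\text{-Mod}$. The *completion* $\mathfrak S(\mathscr S)$ carries the shift $\Sigma$ and, as its class of triangles, the sequences $A\to B\to C\to\Sigma A$ in $\mathfrak S(\mathscr S)$ isomorphic to the colimit of the image under $\mathfrak y$ of a sequence of triangles $A_n\to B_n\to C_n\to A_n[1]$ of $\mathscr S$ (with maps of triangles between them) for which $\{A_n\}$, $\{B_n\}$, $\{C_n\}$ are Cauchy. Let $(\mathscr S^{\leqslant 0},\mathscr S^{\geqslant 0})$ be a $t$-structure on $\mathscr S$ (with $\mathscr S^{\leqslant n}=\mathscr S^{\leqslant 0}[-n]$, $\mathscr S^{\geqslant n}=\mathscr S^{\geqslant 0}[-n]$) with heart $\mathscr H=\mathscr S^{\leqslant 0}\cap\mathscr S^{\geqslant 0}$, and suppose that it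 is *extendable*, that is, $\mathscr M_n\subseteq\mathscr S^{\leqslant 0}$ for some $n$. Then $\mathfrak S(\mathscr S)$, with the shift $\Sigma$ and the triangles above, is a triangulated category, and the following hold. 1. The pair $(\mathfrak S(\mathscr S^{\leqslant 0}),\mathfrak S(\mathscr S^{\geqslant 0}))$ is a $t$-structure on $\mathfrak S(\mathscr S)$, and its heart is $\mathfrak y(\mathscr H)$ (the essential image). 2. For every full subcategory $\mathscr R$ of $\mathscr S^{\geqslant 0}$, the functor $\mathfrak y$ restricts to an additive equivalence $\mathscr R\to\mathfrak S(\mathscr R)$. Moreover, $\mathscr H$ and $\mathfrak S(\mathscr H)$ are abelian categories, and $\mathfrak y$ restricts to an (exact) equivalence of abelian categories $\mathscr H\to\mathfrak S(\mathscr H)$. 3. If $(\mathscr S^{\leqslant 0},\mathscr S^{\geqslant 0})$ is bounded above, i.e. $\mathscr S=\bigcup_n\mathscr S^{\leqslant n}$, then so is the $t$-structure $(\mathfrak S(\mathscr S^{\leqslant 0}),\mathfrak S(\mathscr S^{\geqslant 0}))$ on $\mathfrak S(\mathscr S)$. 4. If $(\mathscr S^{\leqslant 0},\mathscr S^{\geqslant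 0})$ is bounded below, i.e. $\mathscr S=\bigcup_n\mathscr S^{\geqslant -n}$, then $\mathfrak y$ restricts to a fully faithful triangle functor $\mathscr S\to\mathfrak S(\mathscr S)$, with $\mathfrak y(\mathscr S^{\leqslant 0})\subseteq\mathfrak S(\mathscr S^{\leqslant 0})$ and $\mathfrak y(\mathscr S^{\geqslant 0})=\mathfrak S(\mathscr S^{\geqslant 0})$ (essential image). -/

import Mathlib

open CategoryTheory Limits ZeroObject Opposite Pretriangulated Triangulated

universe v u

namespace MetricCompletion

noncomputable section

section ShiftLemmas

variable {S : Type u} [Category.{v} S] [HasShift S ℤ]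

lemma shiftAdd_zero_right (n z m : ℤ) (hz : z = 0) (h : n + z = m) (X : S) :
    (shiftFunctorAdd' S n z m h).inv.app X =
      (shiftFunctorZero' S z hz).hom.app (X⟦n⟧) ≫
        eqToHom (show X⟦n⟧ = X⟦m⟧ by rw [← h, hz, add_zero]) := by
  obtain rfl := hz
  obtain rfl : m = n := by lia
  simp [shiftFunctorAdd'_add_zero_inv_app, shiftFunctorZero']

lemma shiftAdd_zero_left (z n m : ℤ) (hz : z = 0) (h : z + n = m) (X : S) :
    (shiftFunctorAdd' S z n m h).inv.app X =
      ((shiftFunctorZero' S z hz).hom.app X)⟦n⟧' ≫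
        eqToHom (show X⟦n⟧ = X⟦m⟧ by rw [← h, hz, zero_add]) := by
  obtain rfl := hz
  obtain rfl : m = n := by lia
  simp [shiftFunctorAdd'_zero_add_inv_app, shiftFunctorZero']

lemma shiftMap_compIsoId_zero (z : ℤ) (hz : z = 0) {X Y : S} (g : Y ⟶ X⟦(0 : ℤ)⟧) :
    g⟦z⟧' ≫ (shiftFunctorCompIsoId S 0 z (by lia)).hom.app X =
      (shiftFunctorZero' S z hz).hom.app Y ≫ g ≫ (shiftFunctorZero S ℤ).hom.app X := by
  subst hz
  simp [shiftFunctorCompIsoId_zero_zero_hom_app, shiftFunctorZero']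

lemma shiftMap_compIsoId_add (a b : ℤ) {X Y : S} (g : Y ⟶ X⟦a + b⟧) :
    g⟦-(a + b)⟧' ≫ (shiftFunctorCompIsoId S (a + b) (-(a + b)) (by lia)).hom.app X =
      (shiftFunctorAdd' S (-b) (-a) (-(a + b)) (by lia)).hom.app Y ≫
        ((g ≫ (shiftFunctorAdd S a b).hom.app X)⟦-b⟧' ≫
          (shiftFunctorCompIsoId S b (-b) (by lia)).hom.app (X⟦a⟧))⟦-a⟧' ≫
        (shiftFunctorCompIsoId S a (-a) (by lia)).hom.app X := by
  rw [shiftFunctorCompIsoId_add'_hom_app (-b) (-a) (-(a + b)) b a (a + b)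
    (by lia) (by lia) (by lia) (by lia), shiftFunctorAdd'_eq_shiftFunctorAdd]
  simp only [Functor.map_comp, Category.assoc]
  have h := (shiftFunctorAdd' S (-b) (-a) (-(a + b)) (by lia)).hom.naturality
    (g ≫ (shiftFunctorAdd S a b).hom.app X)
  simp only [Functor.map_comp, Functor.comp_map, Category.assoc] at h
  rw [reassoc_of% h]

end ShiftLemmas

section Presheaves

variable (S : Type u) [Category.{v} S] [Preadditive S] [HasShift S ℤ]
  [∀ n : ℤ, (shiftFunctor S n).Additive]

/-- The category of additive functors from `Sᵒᵖ` to abelian groups. -/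
abbrev SMod (S : Type u) [Category.{v} S] [Preadditive S] : Type _ := Sᵒᵖ ⥤+ AddCommGrpCat.{v}

/-- The functor `F ↦ (X ↦ F (X⟦-n⟧))`. -/
def sigma (n : ℤ) : SMod S ⥤ SMod S where
  obj F := ⟨(shiftFunctor S (-n)).op ⋙ F.obj, by
    have := F.property
    change F.obj.Additive at this
    change Functor.Additive _
    infer_instance⟩
  map α := ⟨Functor.whiskerLeft (shiftFunctor S (-n)).op α.hom⟩

/-- The shift by `0` is isomorphic to the identity. -/
def sigmaZero : sigma S 0 ≅ 𝟭 (SMod S) :=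
  NatIso.ofComponents (fun F ↦ ObjectProperty.isoMk _
    (NatIso.ofComponents (fun X ↦ F.obj.mapIso
      ((shiftFunctorZero' S (-0 : ℤ) neg_zero).symm.app X.unop).op) (by
        intro X Y f
        simp only [sigma, Functor.mapIso_hom, Functor.comp_map]
        erw [← F.obj.map_comp, ← F.obj.map_comp]
        congr 1
        apply Quiver.Hom.unop_inj
        exact ((shiftFunctorZero' S (-0 : ℤ) neg_zero).inv.naturality f.unop).symm))) (by
    intro F G α
    ext X : 3
    exact (α.hom.naturality _).symm)

/-- The shift by `a + b` is isomorphic to the shift by `a` followed by the shift by `b`. -/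
def sigmaAdd (a b : ℤ) : sigma S (a + b) ≅ sigma S a ⋙ sigma S b :=
  NatIso.ofComponents (fun F ↦ ObjectProperty.isoMk _
    (NatIso.ofComponents (fun X ↦ F.obj.mapIso
      ((shiftFunctorAdd' S (-b) (-a) (-(a + b)) (by lia)).symm.app X.unop).op) (by
        intro X Y f
        simp only [sigma, Functor.mapIso_hom, Functor.comp_map]
        erw [← F.obj.map_comp, ← F.obj.map_comp]
        congr 1
        apply Quiver.Hom.unop_inj
        exact ((shiftFunctorAdd' S (-b) (-a) (-(a + b)) (by lia)).inv.naturality f.unop).symm))) (by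
    intro F G α
    ext X : 3
    exact (α.hom.naturality _).symm)

variable {S}

lemma sigmaZero_inv_app (F : SMod S) (X : Sᵒᵖ) :
    ((sigmaZero S).inv.app F).hom.app X =
      F.obj.map ((shiftFunctorZero' S (-0 : ℤ) neg_zero).hom.app X.unop).op := rfl

lemma sigmaZero_hom_app (F : SMod S) (X : Sᵒᵖ) :
    ((sigmaZero S).hom.app F).hom.app X =
      F.obj.map ((shiftFunctorZero' S (-0 : ℤ) neg_zero).inv.app X.unop).op := rfl

lemma sigmaAdd_hom_app (a b : ℤ) (F : SMod S) (X : Sᵒᵖ) :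
    ((sigmaAdd S a b).hom.app F).hom.app X =
      F.obj.map ((shiftFunctorAdd' S (-b) (-a) (-(a + b)) (by lia)).inv.app X.unop).op := rfl

lemma sigmaAdd_inv_app (a b : ℤ) (F : SMod S) (X : Sᵒᵖ) :
    ((sigmaAdd S a b).inv.app F).hom.app X =
      F.obj.map ((shiftFunctorAdd' S (-b) (-a) (-(a + b)) (by lia)).hom.app X.unop).op := rfl

lemma eqToHom_sigma {a b : ℤ} (h : a = b) (F : SMod S) (X : Sᵒᵖ)
    (e : (sigma S a).obj F = (sigma S b).obj F) :
    (eqToHom e).hom.app X =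
      F.obj.map (eqToHom (show X.unop⟦-b⟧ = X.unop⟦-a⟧ by rw [h])).op := by
  subst h
  exact (F.obj.map_id _).symm

lemma eqToHom_sigma_comp {a b c d : ℤ} (h : a = b) (F : SMod S) (X : Sᵒᵖ)
    (hcd : (-c) + (-d) = -a) (e : (sigma S a).obj F = (sigma S b).obj F) :
    (eqToHom e).hom.app X ≫
      F.obj.map ((shiftFunctorAdd' S (-c) (-d) (-b) (by lia)).inv.app X.unop).op =
      F.obj.map ((shiftFunctorAdd' S (-c) (-d) (-a) hcd).inv.app X.unop).op := by
  subst h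
  exact Category.id_comp _

variable (S) in
/-- The data of the `ℤ`-indexed shift on additive presheaves. -/
def sigmaCore : ShiftMkCore (SMod S) ℤ where
  F := sigma S
  zero := sigmaZero S
  add := sigmaAdd S
  assoc_hom_app a b c F := by
    ext X : 3
    refine Eq.trans ?_ (Category.assoc _ _ _)
    refine Eq.trans ?_ (congrArg (· ≫ ((sigmaAdd S b c).hom.app ((sigma S a).obj F)).hom.app X)
      (eqToHom_sigma_comp (add_assoc a b c) F X (by lia) _).symm)
    refine (F.obj.map_comp _ _).symm.trans (Eq.trans ?_ (F.obj.map_comp _ _))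
    congr 1
    apply Quiver.Hom.unop_inj
    exact (shiftFunctorAdd'_assoc_inv_app (-c) (-b) (-a) (-(b + c)) (-(a + b)) (-(a + b + c))
      (by lia) (by lia) (by lia) X.unop).symm
  zero_add_hom_app n F := by
    ext X : 3
    refine Eq.trans ?_ (congrArg (· ≫ ((sigmaZero S).inv.app F).hom.app (op (X.unop⟦-n⟧)))
      (eqToHom_sigma (zero_add n) F X _).symm)
    refine Eq.trans ?_ (F.obj.map_comp _ _)
    rw [sigmaAdd_hom_app]
    congr 1
    apply Quiver.Hom.unop_inj
    exact shiftAdd_zero_right (-n) (-0) (-(0 + n)) neg_zero (by lia) X.unop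
  add_zero_hom_app n F := by
    ext X : 3
    refine Eq.trans ?_ (congrArg (· ≫ ((sigmaZero S).inv.app ((sigma S n).obj F)).hom.app X)
      (eqToHom_sigma (add_zero n) F X _).symm)
    refine Eq.trans ?_ (F.obj.map_comp _ _)
    rw [sigmaAdd_hom_app]
    congr 1
    apply Quiver.Hom.unop_inj
    exact shiftAdd_zero_left (-0) (-n) (-(n + 0)) neg_zero (by lia) X.unop

instance : HasShift (SMod S) ℤ := hasShiftMk _ _ (sigmaCore S)

instance (n : ℤ) : (shiftFunctor (SMod S) n).Additive where
  map_add := rfl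

variable (S) in
/-- The Yoneda functor `X ↦ Hom(-, X)`. -/
def yon : S ⥤ SMod S :=
  ObjectProperty.lift _ preadditiveYoneda (fun X ↦ additive_yonedaObj' X)

instance : (yon S).Full := by
  have : (yon S ⋙ AdditiveFunctor.forget Sᵒᵖ AddCommGrpCat.{v}).Full :=
    full_preadditiveYoneda
  exact Functor.Full.of_comp_faithful _ (AdditiveFunctor.forget Sᵒᵖ AddCommGrpCat.{v})

instance : (yon S).Faithful := by
  have : (yon S ⋙ AdditiveFunctor.forget Sᵒᵖ AddCommGrpCat.{v}).Faithful :=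
    faithful_preadditiveYoneda
  exact Functor.Faithful.of_comp _ (AdditiveFunctor.forget Sᵒᵖ AddCommGrpCat.{v})

instance : (yon S).Additive where
  map_add {X Y f g} := by
    ext Z (h : Z.unop ⟶ X)
    exact Preadditive.comp_add _ _ _ h f g

/-- The canonical bijection `Hom(Y, X⟦n⟧) ≃ Hom(Y⟦-n⟧, X)`. -/
def homShiftEquiv (n : ℤ) (Y X : S) : (Y ⟶ X⟦n⟧) ≃+ (Y⟦-n⟧ ⟶ X) where
  toFun g := g⟦-n⟧' ≫ (shiftFunctorCompIsoId S n (-n) (add_neg_cancel n)).hom.app X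
  invFun h := (shiftFunctorCompIsoId S (-n) n (neg_add_cancel n)).inv.app Y ≫ h⟦n⟧'
  left_inv g := (((shiftEquiv' S (-n) n (neg_add_cancel n)).toAdjunction.homEquiv Y X)).right_inv g
  right_inv h := (((shiftEquiv' S (-n) n (neg_add_cancel n)).toAdjunction.homEquiv Y X)).left_inv h
  map_add' f g := by simp

variable (S) in
/-- The isomorphism of `Hom(-, X⟦n⟧)` with the shift of `Hom(-, X)` by `n`. -/
def yonShiftIso (n : ℤ) : shiftFunctor S n ⋙ yon S ≅ yon S ⋙ shiftFunctor (SMod S) n :=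
  NatIso.ofComponents (fun X ↦ ObjectProperty.isoMk _
    (NatIso.ofComponents (fun Y ↦ (homShiftEquiv n Y.unop X).toAddCommGrpIso) (by
        intro Y Z f
        ext (g : Y.unop ⟶ X⟦n⟧)
        change (f.unop ≫ g)⟦-n⟧' ≫ _ = f.unop⟦-n⟧' ≫ g⟦-n⟧' ≫ _
        simp))) (by
    intro X X' f
    ext Y (g : Y.unop ⟶ X⟦n⟧)
    change (g ≫ f⟦n⟧')⟦-n⟧' ≫ _ = (g⟦-n⟧' ≫ _) ≫ f
    rw [Functor.map_comp, Category.assoc, Category.assoc]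
    congr 1
    exact (shiftFunctorCompIsoId S n (-n) (add_neg_cancel n)).hom.naturality f)

lemma yonShiftIso_hom_apply (n : ℤ) (X Y : S) (g : Y ⟶ X⟦n⟧) :
    (((yonShiftIso S n).hom.app X).hom.app (op Y)).hom g =
      g⟦-n⟧' ≫ (shiftFunctorCompIsoId S n (-n) (add_neg_cancel n)).hom.app X := rfl

instance : (yon S).CommShift ℤ where
  commShiftIso := yonShiftIso S
  commShiftIso_zero := by
    ext X Y (g : Y.unop ⟶ X⟦(0 : ℤ)⟧)
    rw [Functor.CommShift.isoZero_hom_app]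
    exact shiftMap_compIsoId_zero (-0) neg_zero g
  commShiftIso_add a b := by
    ext X Y (g : Y.unop ⟶ X⟦a + b⟧)
    rw [Functor.CommShift.isoAdd_hom_app]
    exact shiftMap_compIsoId_add a b g

end Presheaves

section Metrics

variable (S : Type u) [Category.{v} S] [Preadditive S] [HasZeroObject S] [HasShift S ℤ]
  [∀ n : ℤ, (shiftFunctor S n).Additive] [Pretriangulated S]

/-- A good metric on a triangulated category. Here `extensionProduct P Q` is `P * Q`, the property
of being the middle term of a distinguished triangle with outer terms in `P` and `Q`. -/
structure GoodMetric where
  /-- the sequence of full subcategories -/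
  M : ℕ → ObjectProperty S
  containsZero (n : ℕ) : (M n).ContainsZero
  extension (n : ℕ) : ObjectProperty.extensionProduct (M n) (M n) = M n
  shift_neg (n : ℕ) (X : S) : M (n + 1) X → M n (X⟦(-1 : ℤ)⟧)
  descending (n : ℕ) (X : S) : M (n + 1) X → M n X
  shift_pos (n : ℕ) (X : S) : M (n + 1) X → M n (X⟦(1 : ℤ)⟧)

namespace GoodMetric

variable {S} (𝓜 : GoodMetric S)

/-- A chain `X 0 ⟶ X 1 ⟶ ⋯` is Cauchy if for every `i` the cones of all but finitely many of
its morphisms lie in `M i`. Here `P.trW f` says that a cone of `f` satisfies `P`. -/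
def IsCauchy (X : ℕ ⥤ S) : Prop :=
  ∀ i : ℕ, ∃ N : ℕ, ∀ n : ℕ, N ≤ n → (𝓜.M i).trW (X.map (homOfLE (Nat.le_succ n)))

/-- `𝔏(A)`: the colimits, in the category of additive presheaves, of Cauchy sequences with terms
in `A`. -/
def colimits (A : ObjectProperty S) : ObjectProperty (SMod S) := fun F ↦
  ∃ X : ℕ ⥤ S, 𝓜.IsCauchy X ∧ (∀ n, A (X.obj n)) ∧
    ∃ α : X ⋙ yon S ⟶ (Functor.const ℕ).obj F, Nonempty (IsColimit (Cocone.mk F α))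

/-- `ℭ(S)`: the additive presheaves that vanish on some `M j`. -/
def compactlySupported : ObjectProperty (SMod S) := fun F ↦
  ∃ j : ℕ, ∀ X : S, 𝓜.M j X → IsZero (F.obj.obj (op X))

/-- `𝔖(A) = 𝔏(A) ∩ ℭ(S)`. -/
def completionOf (A : ObjectProperty S) : ObjectProperty (SMod S) :=
  𝓜.colimits A ⊓ 𝓜.compactlySupported

lemma isClosedUnderIsomorphisms (n : ℕ) : (𝓜.M n).IsClosedUnderIsomorphisms where
  of_iso {X Y} e hX := by
    obtain ⟨Z, hZ, hZ'⟩ := (𝓜.containsZero n).exists_zero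
    rw [← 𝓜.extension n, ObjectProperty.extensionProduct_iff]
    refine ⟨X, Z, e.hom, 0, 0, ?_, hX, hZ'⟩
    exact isomorphic_distinguished _ (contractible_distinguished X) _
      (Triangle.isoMk _ _ (Iso.refl _) e.symm (hZ.iso (isZero_zero _))
        (e.hom_inv_id.trans (Category.comp_id _).symm) (zero_comp.trans comp_zero.symm)
        (zero_comp.trans comp_zero.symm))

lemma shift_nat (k : ℕ) : ∀ (n : ℕ) (X : S), 𝓜.M (n + k) X →
    𝓜.M n (X⟦(k : ℤ)⟧) ∧ 𝓜.M n (X⟦-(k : ℤ)⟧) := by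
  induction k with
  | zero =>
    intro n X hX
    have := 𝓜.isClosedUnderIsomorphisms n
    exact ⟨(𝓜.M n).prop_of_iso ((shiftFunctorZero' S ((0 : ℕ) : ℤ) (by simp)).symm.app X) hX,
      (𝓜.M n).prop_of_iso ((shiftFunctorZero' S (-((0 : ℕ) : ℤ)) (by simp)).symm.app X) hX⟩
  | succ k ih =>
    intro n X hX
    have := 𝓜.isClosedUnderIsomorphisms n
    obtain ⟨h₁, h₂⟩ := ih (n + 1) X (by rwa [show n + 1 + k = n + (k + 1) by lia])
    exact ⟨(𝓜.M n).prop_of_iso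
        ((shiftFunctorAdd' S (k : ℤ) 1 ((k + 1 : ℕ) : ℤ) (by simp)).symm.app X)
        (𝓜.shift_pos n _ h₁),
      (𝓜.M n).prop_of_iso
        ((shiftFunctorAdd' S (-(k : ℤ)) (-1) (-((k + 1 : ℕ) : ℤ)) (by lia)).symm.app X)
        (𝓜.shift_neg n _ h₂)⟩

lemma shift_int (j : ℤ) (n : ℕ) (X : S) (hX : 𝓜.M (n + j.natAbs) X) : 𝓜.M n (X⟦j⟧) := by
  obtain ⟨h₁, h₂⟩ := 𝓜.shift_nat _ n X hX
  rcases Int.natAbs_eq j with h | h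
  · rwa [← h] at h₁
  · rwa [← h] at h₂

lemma IsCauchy.shift {X : ℕ ⥤ S} (hX : 𝓜.IsCauchy X) (j : ℤ) :
    𝓜.IsCauchy (X ⋙ shiftFunctor S j) := by
  intro i
  obtain ⟨N, hN⟩ := hX (i + j.natAbs)
  refine ⟨N, fun n hn ↦ ?_⟩
  obtain ⟨Z, g, h, hT, hZ⟩ := hN n hn
  rw [← ObjectProperty.smul_mem_trW_iff _ _ j.negOnePow]
  exact ⟨_, _, _, Triangle.shift_distinguished _ hT j, 𝓜.shift_int j i Z hZ⟩

lemma isCauchy_const (X : S) : 𝓜.IsCauchy ((Functor.const ℕ).obj X) := by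
  intro i
  refine ⟨0, fun n _ ↦ ?_⟩
  have := 𝓜.containsZero i
  have := 𝓜.isClosedUnderIsomorphisms i
  exact MorphismProperty.id_mem (𝓜.M i).trW X

instance : (𝓜.completionOf ⊤).IsStableUnderShift ℤ where
  isStableUnderShiftBy a := ⟨by
    rintro F ⟨⟨X, hX, -, α, ⟨hα⟩⟩, j, hj⟩
    refine ⟨⟨X ⋙ shiftFunctor S a, hX.shift 𝓜 a, fun _ ↦ trivial,
      Functor.whiskerLeft X ((yon S).commShiftIso a).hom ≫
        Functor.whiskerRight α (shiftFunctor (SMod S) a), ⟨?_⟩⟩, j + (-a).natAbs, ?_⟩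
    · have h := isColimitOfPreserves (shiftFunctor (SMod S) a) hα
      refine (IsColimit.equivOfNatIsoOfIso
        (Functor.isoWhiskerLeft X ((yon S).commShiftIso a)).symm _ _ ?_) h
      exact Cocone.ext (Iso.refl _) (fun n ↦ Category.comp_id _)
    · intro Y hY
      exact hj _ (𝓜.shift_int (-a) j Y hY)⟩

instance : (𝓜.completionOf ⊤).ContainsZero where
  exists_zero := by
    refine ⟨(yon S).obj 0, (yon S).map_isZero (isZero_zero S), ⟨(Functor.const ℕ).obj 0,
      𝓜.isCauchy_const 0, fun _ ↦ trivial, 0, ⟨?_⟩⟩, 0, fun X _ ↦ ?_⟩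
    · exact
        { desc := fun s ↦ s.ι.app 0
          fac := fun s n ↦ (((yon S).map_isZero (isZero_zero S)).eq_of_src _ _)
          uniq := fun s m hm ↦ (((yon S).map_isZero (isZero_zero S)).eq_of_src _ _) }
    · have := ((evaluation Sᵒᵖ AddCommGrpCat.{v}).obj (op X)).map_isZero
        ((AdditiveFunctor.forget Sᵒᵖ AddCommGrpCat.{v}).map_isZero
          ((yon S).map_isZero (isZero_zero S)))
      exact this

/-- The completion `𝔖(S)`. -/
abbrev Completion : Type _ := (𝓜.completionOf ⊤).FullSubcategory

/-- The triangles of `𝔖(S)`: those that, in the category of additive presheaves, are colimits of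
the image under the Yoneda functor of a Cauchy sequence of distinguished triangles of `S`. -/
def completionTriangles : Set (Triangle 𝓜.Completion) := fun T ↦
  ∃ D : ℕ ⥤ Triangle S, (∀ n, D.obj n ∈ distTriang S) ∧
    𝓜.IsCauchy (D ⋙ Triangle.π₁) ∧ 𝓜.IsCauchy (D ⋙ Triangle.π₂) ∧
    𝓜.IsCauchy (D ⋙ Triangle.π₃) ∧
    ∃ α : D ⋙ (yon S).mapTriangle ⟶
        (Functor.const ℕ).obj ((𝓜.completionOf ⊤).ι.mapTriangle.obj T),
      Nonempty (IsColimit (Triangle.π₁.mapCocone (Cocone.mk _ α))) ∧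
      Nonempty (IsColimit (Triangle.π₂.mapCocone (Cocone.mk _ α))) ∧
      Nonempty (IsColimit (Triangle.π₃.mapCocone (Cocone.mk _ α)))

/-- `𝔖(A)` as a full subcategory of the completion `𝔖(S)`. -/
def inCompletion (A : ObjectProperty S) : ObjectProperty 𝓜.Completion :=
  (𝓜.completionOf A).inverseImage (𝓜.completionOf ⊤).ι

/-- A t-structure is extendable if its aisle contains some `M n`. -/
def IsExtendable (t : TStructure S) : Prop :=
  ∃ n : ℕ, 𝓜.M n ≤ t.le 0

/-- The functor `A ⥤ 𝔖(A)` that the Yoneda functor restricts to, if it sends the objects of `A`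
into `𝔖(A)`. -/
def yonRestrict (A : ObjectProperty S)
    (h : ∀ X : A.FullSubcategory, 𝓜.completionOf A ((yon S).obj X.obj)) :
    A.FullSubcategory ⥤ (𝓜.completionOf A).FullSubcategory :=
  ObjectProperty.lift _ (A.ι ⋙ yon S) h

/-- The functor `S ⥤ 𝔖(S)` that the Yoneda functor restricts to, if it sends the objects of `S`
into `𝔖(S)`. -/
abbrev yonLift (h : ∀ X : S, 𝓜.completionOf ⊤ ((yon S).obj X)) : S ⥤ 𝓜.Completion :=
  ObjectProperty.lift _ (yon S) h

end GoodMetric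

/-- The preadditive category `C` is abelian (for its given additive structure). -/
def IsAbelianCategory (C : Type*) [Category C] [hC : Preadditive C] : Prop :=
  ∃ h : Abelian C, h.toPreadditive = hC

end Metrics

end

end MetricCompletion

set_option linter.unusedSectionVars false

namespace MetricCompletion

/-! ### Sequential colimits of representables, seen through maps out of representables. -/

section IndLimits

/-! Two finiteness properties carry the proof. First, representables are compact: a map from one of
them to a sequential colimit comes from a finite stage, and it vanishes only if it already vanishes
at a later stage. `IsIndLimit` records this and is used in place of the colimit property. Secondly,
seen from suitable targets, a Cauchy colimit looks like one of its late terms. If `G` is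
cohomological and vanishes on `M i` (`IsTest`), late transition maps have small cones and induce
bijections on maps into `G`, so maps `F ⟶ G` are the same as maps to `G` from a late term
(`IsCauchy.exists_isApprox`). Objects of the completion are Cauchy colimits and also test presheaves
(`exists_isTest`), so morphisms between them can be built and compared at a single late stage.

For the triangulation, a morphism is lifted to a map of Cauchy sequences. Its cones are chosen
compatibly, with octahedra keeping them Cauchy (`exists_cone`), and the colimit is again compactly
supported (`isTest₃`). Completion of morphisms and the octahedral axiom are solved at one stage in
`S`, and the solution is extended along approximations. `IndTriangle.of_isApprox` then says that a
triangle of test presheaves, approximated closely enough by a distinguished triangle of `S`, is a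
colimit triangle.

For the t-structure, shifting the metric puts some `M k` inside any given `t.le n`. A Cauchy
sequence in `t.ge n` has late cones both in `t.ge (n - 1)` and in `t.le (n - 2)`, hence zero. The
sequence is eventually constant up to isomorphism, so its colimit is representable
(`exists_yon_iso`). Truncation of `F` truncates one late term `X N`: the map from `X N` to its part
`B` in `t.ge 1` extends to `F`, since `B` represents a test presheaf, and the cones of the resulting
maps from later terms to `B` stay in `t.le (-1)`. -/

instance {C : Type*} [Category* C] [Preadditive C] :
    (additiveFunctor C AddCommGrpCat.{v}).IsClosedUnderColimitsOfShape ℕ where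
  colimitsOfShape_le := by
    rintro F ⟨p⟩
    change F.Additive
    refine ⟨fun {X Y f g} ↦ ?_⟩
    refine (isColimitOfPreserves ((evaluation _ _).obj X) p.isColimit).hom_ext fun n ↦ ?_
    have : (p.diag.obj n).Additive := p.prop_diag_obj n
    change (p.ι.app n).app X ≫ F.map (f + g) = (p.ι.app n).app X ≫ (F.map f + F.map g)
    rw [Preadditive.comp_add]
    erw [← (p.ι.app n).naturality, ← (p.ι.app n).naturality, ← (p.ι.app n).naturality]
    rw [Functor.map_add, Preadditive.add_comp]

variable {S : Type u} [Category.{v} S] [Preadditive S] [HasShift S ℤ]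
  [∀ n : ℤ, (shiftFunctor S n).Additive]

instance : HasColimitsOfShape ℕ (SMod S) := inferInstance

/-- The Yoneda lemma for additive presheaves. -/
def yonEquiv (Y : S) (F : SMod S) : ((yon S).obj Y ⟶ F) ≃+ F.obj.obj (op Y) where
  toFun s := (s.hom.app (op Y)).hom (𝟙 Y : Y ⟶ Y)
  invFun x := ⟨{
    app Z := AddCommGrpCat.ofHom
      { toFun := fun (g : Z.unop ⟶ Y) ↦ (F.obj.map g.op).hom x
        map_zero' := by
          change (F.obj.map (0 : op Y ⟶ Z)).hom x = 0
          rw [F.obj.map_zero]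
          rfl
        map_add' := fun g g' ↦ by
          change (F.obj.map ((g.op + g'.op : op Y ⟶ Z))).hom x = _
          rw [F.obj.map_add]
          rfl }
    naturality := by
      intro Z W f
      ext (g : Z.unop ⟶ Y)
      change (F.obj.map (f.unop ≫ g).op).hom x = (F.obj.map f).hom ((F.obj.map g.op).hom x)
      rw [op_comp, F.obj.map_comp]
      rfl }⟩
  left_inv s := by
    ext Z (g : Z.unop ⟶ Y)
    have h := ConcreteCategory.congr_hom (s.hom.naturality g.op) (𝟙 Y : Y ⟶ Y)
    refine h.symm.trans ?_
    change (s.hom.app Z).hom (g ≫ 𝟙 Y) = _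
    rw [Category.comp_id]
  right_inv x := by
    change (F.obj.map (𝟙 Y : Y ⟶ Y).op).hom x = x
    rw [op_id, F.obj.map_id]
    rfl
  map_add' s s' := rfl

lemma yonEquiv_comp {Y : S} {F G : SMod S} (s : (yon S).obj Y ⟶ F) (φ : F ⟶ G) :
    yonEquiv Y G (s ≫ φ) = (φ.hom.app (op Y)).hom (yonEquiv Y F s) := rfl

lemma yonEquiv_map_comp {Y X : S} {F : SMod S} (g : Y ⟶ X) (s : (yon S).obj X ⟶ F) :
    yonEquiv Y F ((yon S).map g ≫ s) = (s.hom.app (op Y)).hom g := by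
  change (s.hom.app (op Y)).hom (𝟙 Y ≫ g) = _
  rw [Category.id_comp]

lemma isIso_of_bijective {F G : SMod S} (φ : F ⟶ G)
    (h : ∀ Y : S, Function.Bijective (fun s : (yon S).obj Y ⟶ F ↦ s ≫ φ)) : IsIso φ := by
  have : IsIso ((AdditiveFunctor.forget Sᵒᵖ AddCommGrpCat.{v}).map φ) := by
    rw [NatTrans.isIso_iff_isIso_app]
    intro Y
    rw [ConcreteCategory.isIso_iff_bijective]
    have := (yonEquiv Y.unop G).bijective.comp ((h Y.unop).comp (yonEquiv Y.unop F).symm.bijective)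
    convert! this using 1
    ext x
    exact ((yonEquiv_comp _ _).trans
      (congrArg _ ((yonEquiv Y.unop F).apply_symm_apply x))).symm
  exact isIso_of_fully_faithful (AdditiveFunctor.forget Sᵒᵖ AddCommGrpCat.{v}) φ

lemma hom_ext_yon {F G : SMod S} {φ ψ : F ⟶ G}
    (h : ∀ (Y : S) (s : (yon S).obj Y ⟶ F), s ≫ φ = s ≫ ψ) : φ = ψ := by
  ext Y x
  have := congrArg (yonEquiv Y.unop G) (h Y.unop ((yonEquiv Y.unop F).symm x))
  rw [yonEquiv_comp, yonEquiv_comp, AddEquiv.apply_symm_apply] at this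
  exact this

/-- The maps `ι n` exhibit `F` as the colimit of the presheaves represented by `X n`, expressed
in terms of morphisms from representable presheaves. -/
structure IsIndLimit (X : ℕ ⥤ S) (F : SMod S) (ι : ∀ n, (yon S).obj (X.obj n) ⟶ F) : Prop where
  w {n m : ℕ} (h : n ⟶ m) : (yon S).map (X.map h) ≫ ι m = ι n
  exists_fac {Y : S} (s : (yon S).obj Y ⟶ F) :
    ∃ (n : ℕ) (g : Y ⟶ X.obj n), (yon S).map g ≫ ι n = s
  exists_eq_zero {Y : S} {n : ℕ} (g : Y ⟶ X.obj n) (hg : (yon S).map g ≫ ι n = 0) :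
    ∃ (m : ℕ) (h : n ⟶ m), g ≫ X.map h = 0

/-- Colimits of additive presheaves over `ℕ` are computed pointwise and on underlying sets, so
elements of `F(Y)`, i.e. maps from the representable of `Y`, and their vanishing are detected at
finite stages. -/
lemma IsIndLimit.of_isColimit {X : ℕ ⥤ S} {F : SMod S}
    {α : X ⋙ yon S ⟶ (Functor.const ℕ).obj F} (hα : IsColimit (Cocone.mk F α)) :
    IsIndLimit X F α.app := by
  have : PreservesFilteredColimitsOfSize.{0, 0} (CategoryTheory.forget AddCommGrpCat.{v}) :=
    preservesFilteredColimitsOfSize_shrink.{0, v, 0, v} _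
  have h (Y : S) := isColimitOfPreserves ((evaluation _ _).obj (op Y))
    (isColimitOfPreserves (AdditiveFunctor.forget Sᵒᵖ AddCommGrpCat.{v}) hα)
  refine ⟨fun h ↦ (α.naturality h).trans (Category.comp_id _), fun {Y} s ↦ ?_, fun {Y n} g hg ↦ ?_⟩
  · obtain ⟨n, g, hg⟩ := Concrete.isColimit_exists_rep _ (h Y) (yonEquiv Y F s)
    exact ⟨n, g, (yonEquiv Y F).injective ((yonEquiv_map_comp (X := X.obj n) g (α.app n)).trans hg)⟩
  · obtain ⟨m, f, f', hm⟩ := Concrete.isColimit_exists_of_rep_eq _ (h Y)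
      (i := n) (j := n) g (0 : Y ⟶ X.obj n) (by
        have h1 := congrArg (yonEquiv Y F) hg
        rw [yonEquiv_map_comp, map_zero] at h1
        refine h1.trans (map_zero ((α.app n).hom.app (op Y)).hom).symm)
    refine ⟨m, f, Eq.trans hm ?_⟩
    change (0 : Y ⟶ X.obj n) ≫ X.map f' = 0
    simp

lemma exists_isIndLimit (X : ℕ ⥤ S) : ∃ (F : SMod S) (ι : ∀ n, (yon S).obj (X.obj n) ⟶ F),
    IsIndLimit X F ι :=
  ⟨_, _, IsIndLimit.of_isColimit (colimit.isColimit (X ⋙ yon S))⟩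

/-- The conditions of `IsIndLimit` make the comparison map from the actual colimit bijective on maps
out of every representable. -/
lemma IsIndLimit.nonempty_isColimit {X : ℕ ⥤ S} {F : SMod S}
    {α : X ⋙ yon S ⟶ (Functor.const ℕ).obj F} (h : IsIndLimit X F α.app) :
    Nonempty (IsColimit (Cocone.mk F α)) := by
  have h' := IsIndLimit.of_isColimit (colimit.isColimit (X ⋙ yon S))
  have fac (n : ℕ) := colimit.ι_desc (Cocone.mk F α) n
  have : IsIso (colimit.desc _ (Cocone.mk F α)) := by
    refine isIso_of_bijective _ fun Y ↦ ⟨?_, fun s ↦ ?_⟩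
    · refine (injective_iff_map_eq_zero
        (Preadditive.rightComp _ (colimit.desc _ (Cocone.mk F α)))).2 fun s hs ↦ ?_
      obtain ⟨n, g, rfl⟩ := h'.exists_fac s
      have hg : (yon S).map g ≫ α.app n = 0 := by
        rw [← hs]
        exact (congrArg ((yon S).map g ≫ ·) (fac n)).symm.trans (Category.assoc _ _ _).symm
      obtain ⟨m, f, hf⟩ := h.exists_eq_zero g hg
      refine (congrArg ((yon S).map g ≫ ·) (h'.w f)).symm.trans ?_
      refine (Category.assoc _ _ _).symm.trans ?_
      rw [← Functor.map_comp, hf, Functor.map_zero, zero_comp]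
      rfl
    · obtain ⟨n, g, rfl⟩ := h.exists_fac s
      exact ⟨(yon S).map g ≫ colimit.ι (X ⋙ yon S) n, (Category.assoc _ _ _).trans
        (congrArg ((yon S).map g ≫ ·) (fac n))⟩
  exact ⟨IsColimit.ofPointIso (colimit.isColimit (X ⋙ yon S)) (i := this)⟩

namespace IsIndLimit

variable {X : ℕ ⥤ S} {F : SMod S} {ι : ∀ n, (yon S).obj (X.obj n) ⟶ F}

/-- The cocone corresponding to a family of maps from representable presheaves. -/
def cocone (h : IsIndLimit X F ι) : X ⋙ yon S ⟶ (Functor.const ℕ).obj F where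
  app := ι
  naturality _ _ f := (h.w f).trans (Category.comp_id _).symm

lemma isColimit (h : IsIndLimit X F ι) : Nonempty (IsColimit (Cocone.mk F h.cocone)) :=
  nonempty_isColimit h

lemma hom_ext (h : IsIndLimit X F ι) {G : SMod S} {φ ψ : F ⟶ G}
    (hφ : ∀ n, ι n ≫ φ = ι n ≫ ψ) : φ = ψ :=
  hom_ext_yon fun Y s ↦ by
    obtain ⟨n, g, rfl⟩ := h.exists_fac s
    rw [Category.assoc, Category.assoc, hφ]

lemma exists_desc (h : IsIndLimit X F ι) {G : SMod S} (s : ∀ n, (yon S).obj (X.obj n) ⟶ G)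
    (hs : ∀ {n m : ℕ} (f : n ⟶ m), (yon S).map (X.map f) ≫ s m = s n) :
    ∃ φ : F ⟶ G, ∀ n, ι n ≫ φ = s n := by
  obtain ⟨hα⟩ := h.isColimit
  exact ⟨hα.desc (Cocone.mk G
    { app := s, naturality := fun _ _ f ↦ (hs f).trans (Category.comp_id _).symm }),
    fun n ↦ hα.fac _ n⟩

lemma exists_eq (h : IsIndLimit X F ι) {Y : S} {n : ℕ} (g g' : Y ⟶ X.obj n)
    (hg : (yon S).map g ≫ ι n = (yon S).map g' ≫ ι n) :
    ∃ (m : ℕ) (f : n ⟶ m), g ≫ X.map f = g' ≫ X.map f := by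
  obtain ⟨m, f, hf⟩ := h.exists_eq_zero (g - g') (by
    rw [Functor.map_sub, Preadditive.sub_comp, hg, sub_self])
  exact ⟨m, f, by rwa [Preadditive.sub_comp, sub_eq_zero] at hf⟩

/-- A morphism from a representable presheaf factors through all sufficiently late stages. -/
lemma exists_fac_le (h : IsIndLimit X F ι) {Y : S} (s : (yon S).obj Y ⟶ F) :
    ∃ N : ℕ, ∀ n, N ≤ n → ∃ g : Y ⟶ X.obj n, (yon S).map g ≫ ι n = s := by
  obtain ⟨N, g, rfl⟩ := h.exists_fac s
  refine ⟨N, fun n hn ↦ ⟨g ≫ X.map (homOfLE hn), ?_⟩⟩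
  rw [Functor.map_comp, Category.assoc, h.w]

lemma reindex (h : IsIndLimit X F ι) (φ : ℕ ⥤ ℕ) (hφ : ∀ n, n ≤ φ.obj n) :
    IsIndLimit (φ ⋙ X) F (fun n ↦ ι (φ.obj n)) where
  w f := h.w _
  exists_fac {Y} s := by
    obtain ⟨N, hN⟩ := h.exists_fac_le s
    obtain ⟨g, hg⟩ := hN (φ.obj N) (hφ N)
    exact ⟨N, g, hg⟩
  exists_eq_zero {Y n} g hg := by
    obtain ⟨m, f, hf⟩ := h.exists_eq_zero g hg
    refine ⟨max n m, homOfLE (le_max_left _ _), ?_⟩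
    have : φ.map (homOfLE (le_max_left n m)) =
      f ≫ homOfLE ((le_max_right n m).trans (hφ _)) := Subsingleton.elim _ _
    change g ≫ X.map (φ.map _) = 0
    rw [this, X.map_comp, reassoc_of% hf, zero_comp]

lemma congr (h : IsIndLimit X F ι) {ι' : ∀ n, (yon S).obj (X.obj n) ⟶ F}
    (h' : ∀ n, ι' n = ι n) : IsIndLimit X F ι' := by
  obtain rfl : ι' = ι := funext h'
  exact h

lemma of_iso_target {G : SMod S} (h : IsIndLimit X F ι) (e : F ≅ G) :
    IsIndLimit X G (fun n ↦ ι n ≫ e.hom) where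
  w f := by rw [← Category.assoc, h.w]
  exists_fac {Y} s := by
    obtain ⟨n, g, hg⟩ := h.exists_fac (s ≫ e.inv)
    exact ⟨n, g, by rw [reassoc_of% hg, e.inv_hom_id, Category.comp_id]⟩
  exists_eq_zero {Y n} g hg :=
    h.exists_eq_zero g (by rw [← cancel_mono e.hom, Category.assoc, hg, zero_comp])

lemma const (Y : S) : IsIndLimit ((Functor.const ℕ).obj Y) ((yon S).obj Y)
    (fun _ ↦ 𝟙 ((yon S).obj Y)) where
  w f := by
    change (yon S).map (𝟙 Y) ≫ _ = _
    simp
  exists_fac {Z} s := ⟨0, (yon S).preimage s, by simp⟩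
  exists_eq_zero {Z n} g hg := by
    refine ⟨n, 𝟙 n, ?_⟩
    change g ≫ 𝟙 Y = 0
    apply (yon S).map_injective
    simpa using hg

lemma shift (h : IsIndLimit X F ι) (a : ℤ) :
    IsIndLimit (X ⋙ shiftFunctor S a) (F⟦a⟧)
      (fun n ↦ ((yon S).commShiftIso a).hom.app (X.obj n) ≫ (ι n)⟦a⟧') := by
  obtain ⟨hα⟩ := h.isColimit
  refine IsIndLimit.of_isColimit (X := X ⋙ shiftFunctor S a) (F := F⟦a⟧)
    (α := Functor.whiskerLeft X ((yon S).commShiftIso a).hom ≫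
      Functor.whiskerRight h.cocone (shiftFunctor (SMod S) a)) ?_
  have h := isColimitOfPreserves (shiftFunctor (SMod S) a) hα
  refine (IsColimit.equivOfNatIsoOfIso
    (Functor.isoWhiskerLeft X ((yon S).commShiftIso a)).symm _ _ ?_) h
  exact Cocone.ext (Iso.refl _) (fun n ↦ Category.comp_id _)

end IsIndLimit

end IndLimits

/-! ### Moving shifts between a representable source and its target. -/

section ShiftHom

variable {S : Type u} [Category.{v} S] [Preadditive S] [HasShift S ℤ]
  [∀ n : ℤ, (shiftFunctor S n).Additive]

/-- Morphisms from a representable presheaf to a shifted presheaf. -/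
def yonShiftHomEquiv (a : ℤ) (Y : S) (G : SMod S) :
    ((yon S).obj Y ⟶ G⟦a⟧) ≃+ ((yon S).obj (Y⟦-a⟧) ⟶ G) :=
  (yonEquiv Y (G⟦a⟧)).trans (yonEquiv (Y⟦-a⟧) G).symm

lemma yonEquiv_naturality {Y X : S} {F : SMod S} (g : Y ⟶ X) (s : (yon S).obj X ⟶ F) :
    yonEquiv Y F ((yon S).map g ≫ s) = (F.obj.map g.op).hom (yonEquiv X F s) := by
  rw [yonEquiv_map_comp]
  have := ConcreteCategory.congr_hom (s.hom.naturality g.op) (𝟙 X : X ⟶ X)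
  refine Eq.trans ?_ this
  change _ = (s.hom.app (op Y)).hom (g ≫ 𝟙 X)
  rw [Category.comp_id]

lemma yonShiftHomEquiv_naturality (a : ℤ) {Y X : S} (g : Y ⟶ X) {G : SMod S}
    (s : (yon S).obj X ⟶ G⟦a⟧) :
    yonShiftHomEquiv a Y G ((yon S).map g ≫ s) =
      (yon S).map (g⟦-a⟧') ≫ yonShiftHomEquiv a X G s := by
  apply (yonEquiv (Y⟦-a⟧) G).injective
  rw [yonEquiv_naturality]
  unfold yonShiftHomEquiv
  erw [AddEquiv.trans_apply, AddEquiv.trans_apply, AddEquiv.apply_symm_apply,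
    AddEquiv.apply_symm_apply, yonEquiv_naturality]
  rfl

lemma bijective_precomp_shift_iff (a b : ℤ) (h : b = -a) {Y X : S} (g : Y ⟶ X) (G : SMod S) :
    Function.Bijective (fun s : (yon S).obj (X⟦b⟧) ⟶ G ↦ (yon S).map (g⟦b⟧') ≫ s) ↔
      Function.Bijective (fun s : (yon S).obj X ⟶ G⟦a⟧ ↦ (yon S).map g ≫ s) := by
  subst h
  rw [← (yonShiftHomEquiv a Y G).bijective.of_comp_iff',
    ← Function.Bijective.of_comp_iff _ (yonShiftHomEquiv a X G).bijective]
  refine iff_of_eq (congrArg _ (funext fun s ↦ ?_))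
  exact (yonShiftHomEquiv_naturality a g s).symm

end ShiftHom

/-! ### Cohomological presheaves and the five lemma. -/

section Cohomological

variable {S : Type u} [Category.{v} S] [Preadditive S] [HasZeroObject S] [HasShift S ℤ]
  [∀ n : ℤ, (shiftFunctor S n).Additive] [Pretriangulated S]

/-- An additive presheaf is cohomological if it sends distinguished triangles to exact
sequences. -/
def IsCohomological (G : SMod S) : Prop :=
  ∀ T ∈ distTriang S, ∀ s : (yon S).obj T.obj₂ ⟶ G, (yon S).map T.mor₁ ≫ s = 0 →
    ∃ s' : (yon S).obj T.obj₃ ⟶ G, (yon S).map T.mor₂ ≫ s' = s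

/-- A map that dies on the first object of a triangle already does so at a finite stage, where
exactness of Hom in `S` applies. -/
lemma IsIndLimit.isCohomological {X : ℕ ⥤ S} {F : SMod S}
    {ι : ∀ n, (yon S).obj (X.obj n) ⟶ F} (h : IsIndLimit X F ι) : IsCohomological F := by
  intro T hT s hs
  obtain ⟨n, g, rfl⟩ := h.exists_fac s
  rw [← Functor.map_comp_assoc] at hs
  obtain ⟨m, f, hf⟩ := h.exists_eq_zero _ hs
  obtain ⟨k, hk⟩ := Triangle.yoneda_exact₂ T hT (g ≫ X.map f) (by rwa [Category.assoc] at hf)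
  exact ⟨(yon S).map k ≫ ι m, by rw [← Functor.map_comp_assoc, ← hk, Functor.map_comp_assoc, h.w]⟩

lemma IsCohomological.shift {G : SMod S} (h : IsCohomological G) (a : ℤ) :
    IsCohomological (G⟦a⟧) := by
  intro T hT s hs
  obtain ⟨(s' : (yon S).obj (T.obj₃⟦-a⟧) ⟶ G), hs'⟩ := h _
    (Triangle.shift_distinguished T hT (-a)) (yonShiftHomEquiv a _ G s) (by
    change (yon S).map ((-a).negOnePow • T.mor₁⟦-a⟧') ≫ _ = 0
    rw [Functor.map_units_smul, Linear.units_smul_comp, ← yonShiftHomEquiv_naturality, hs, map_zero,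
      smul_zero])
  change (yon S).map ((-a).negOnePow • T.mor₂⟦-a⟧') ≫ s' = _ at hs'
  rw [Functor.map_units_smul, Linear.units_smul_comp, ← Linear.comp_units_smul] at hs'
  refine ⟨(yonShiftHomEquiv a _ G).symm ((-a).negOnePow • s'),
    (yonShiftHomEquiv a _ G).injective ?_⟩
  rw [yonShiftHomEquiv_naturality, AddEquiv.apply_symm_apply, hs']

lemma IsCohomological.exact₃ {G : SMod S} (h : IsCohomological G) {T : Triangle S}
    (hT : T ∈ distTriang S) (s : (yon S).obj T.obj₃ ⟶ G) (hs : (yon S).map T.mor₂ ≫ s = 0) :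
    ∃ s' : (yon S).obj (T.obj₁⟦(1 : ℤ)⟧) ⟶ G, (yon S).map T.mor₃ ≫ s' = s :=
  h _ (rot_of_distTriang _ hT) s hs

lemma IsCohomological.exact₁ {G : SMod S} (h : IsCohomological G) {T : Triangle S}
    (hT : T ∈ distTriang S) (s : (yon S).obj (T.obj₁⟦(1 : ℤ)⟧) ⟶ G)
    (hs : (yon S).map T.mor₃ ≫ s = 0) :
    ∃ s' : (yon S).obj (T.obj₂⟦(1 : ℤ)⟧) ⟶ G, (yon S).map (T.mor₁⟦(1 : ℤ)⟧') ≫ s' = s := by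
  obtain ⟨(s' : (yon S).obj (T.obj₂⟦(1 : ℤ)⟧) ⟶ G), hs'⟩ :=
    h _ (rot_of_distTriang _ (rot_of_distTriang _ hT)) s hs
  -- Rotating twice turns the first map into its negative shift; the sign is absorbed here.
  refine ⟨-s', Eq.trans ?_ hs'⟩
  change _ = (yon S).map (-T.mor₁⟦(1 : ℤ)⟧') ≫ s'
  simp

lemma IsCohomological.exact₁' {G : SMod S} (h : IsCohomological G) {T : Triangle S}
    (hT : T ∈ distTriang S) (s : (yon S).obj T.obj₁ ⟶ G)
    (hs : (yon S).map T.invRotate.mor₁ ≫ s = 0) :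
    ∃ s' : (yon S).obj T.obj₂ ⟶ G, (yon S).map T.mor₁ ≫ s' = s :=
  h _ (inv_rot_of_distTriang _ hT) s hs

/-- A version of the five lemma for morphisms of triangles and a cohomological presheaf. -/
lemma IsCohomological.bijective₃ {G : SMod S} (h : IsCohomological G) {T T' : Triangle S}
    (hT : T ∈ distTriang S) (hT' : T' ∈ distTriang S) (φ : T ⟶ T')
    (h₁ : Function.Injective (fun s : (yon S).obj T'.obj₁ ⟶ G ↦ (yon S).map φ.hom₁ ≫ s))
    (h₂ : Function.Bijective (fun s : (yon S).obj T'.obj₂ ⟶ G ↦ (yon S).map φ.hom₂ ≫ s))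
    (h₁' : Function.Bijective (fun s : (yon S).obj (T'.obj₁⟦(1 : ℤ)⟧) ⟶ G ↦
      (yon S).map (φ.hom₁⟦(1 : ℤ)⟧') ≫ s))
    (h₂' : Function.Surjective (fun s : (yon S).obj (T'.obj₂⟦(1 : ℤ)⟧) ⟶ G ↦
      (yon S).map (φ.hom₂⟦(1 : ℤ)⟧') ≫ s)) :
    Function.Bijective (fun s : (yon S).obj T'.obj₃ ⟶ G ↦ (yon S).map φ.hom₃ ≫ s) := by
  have z₁ : (yon S).map T.mor₁ ≫ (yon S).map T.mor₂ = 0 := by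
    rw [← Functor.map_comp, comp_distTriang_mor_zero₁₂ _ hT, Functor.map_zero]
  have z₃' : (yon S).map T'.mor₃ ≫ (yon S).map (T'.mor₁⟦(1 : ℤ)⟧') = 0 := by
    rw [← Functor.map_comp, comp_distTriang_mor_zero₃₁ _ hT', Functor.map_zero]
  have z₂' : (yon S).map T'.mor₂ ≫ (yon S).map T'.mor₃ = 0 := by
    rw [← Functor.map_comp, comp_distTriang_mor_zero₂₃ _ hT', Functor.map_zero]
  have c₁ := congrArg (yon S).map φ.comm₁
  have c₂ := congrArg (yon S).map φ.comm₂
  have c₃ := congrArg (yon S).map φ.comm₃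
  have c₁' := congrArg (fun f ↦ (yon S).map (f⟦(1 : ℤ)⟧')) φ.comm₁
  simp only [Functor.map_comp] at c₁ c₂ c₃ c₁'
  refine ⟨?_, fun s ↦ ?_⟩
  · refine (injective_iff_map_eq_zero (Preadditive.leftComp G ((yon S).map φ.hom₃))).2 fun u hu ↦ ?_
    replace hu : (yon S).map φ.hom₃ ≫ u = 0 := hu
    obtain ⟨w, rfl⟩ := h.exact₃ hT' u (h₂.1 (by
      dsimp only
      rw [comp_zero, ← reassoc_of% c₂, hu, comp_zero]))
    obtain ⟨x, hx⟩ := h.exact₁ hT ((yon S).map (φ.hom₁⟦(1 : ℤ)⟧') ≫ w) (by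
      rw [reassoc_of% c₃, hu])
    obtain ⟨x', rfl⟩ := h₂' x
    have : w = (yon S).map (T'.mor₁⟦(1 : ℤ)⟧') ≫ x' := h₁'.1 (by
      dsimp only at hx ⊢
      rw [← hx, reassoc_of% c₁'])
    rw [this, reassoc_of% z₃', zero_comp]
  · obtain ⟨t, ht⟩ := h₂.2 ((yon S).map T.mor₂ ≫ s)
    dsimp only at ht
    obtain ⟨u, rfl⟩ := h _ hT' t (h₁ (by
      dsimp only
      rw [comp_zero, ← reassoc_of% c₁, ht, reassoc_of% z₁, zero_comp]))
    obtain ⟨r, hr⟩ := h.exact₃ hT (s - (yon S).map φ.hom₃ ≫ u) (by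
      rw [Preadditive.comp_sub, ← ht, reassoc_of% c₂, sub_self])
    obtain ⟨r', rfl⟩ := h₁'.2 r
    refine ⟨u + (yon S).map T'.mor₃ ≫ r', ?_⟩
    dsimp only at hr ⊢
    rw [Preadditive.comp_add, ← reassoc_of% c₃, hr, add_sub_cancel]

end Cohomological

/-! ### Test presheaves and approximation of Cauchy colimits by their terms. -/

section Approximation

variable {S : Type u} [Category.{v} S] [Preadditive S] [HasZeroObject S] [HasShift S ℤ]
  [∀ n : ℤ, (shiftFunctor S n).Additive] [Pretriangulated S] (𝓜 : GoodMetric S)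

namespace GoodMetric

instance (n : ℕ) : (𝓜.M n).IsClosedUnderIsomorphisms := 𝓜.isClosedUnderIsomorphisms n

instance (n : ℕ) : (𝓜.M n).ContainsZero := 𝓜.containsZero n

lemma M_antitone : Antitone 𝓜.M := antitone_nat_of_succ_le fun n X hX ↦ 𝓜.descending n X hX

/-- By the octahedral axiom the cone of a composite is an extension of the two cones, and `M i` is
closed under extensions. Hence the Cauchy condition controls all late transition maps, not only
consecutive ones. -/
lemma trW_comp [IsTriangulated S] (i : ℕ) {X Y Z : S} {f : X ⟶ Y} {g : Y ⟶ Z}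
    (hf : (𝓜.M i).trW f) (hg : (𝓜.M i).trW g) : (𝓜.M i).trW (f ≫ g) := by
  obtain ⟨A, f₂, f₃, hA, hA'⟩ := hf
  obtain ⟨B, g₂, g₃, hB, hB'⟩ := hg
  obtain ⟨C, k₂, k₃, hC⟩ := distinguished_cocone_triangle (f ≫ g)
  refine ⟨C, k₂, k₃, hC, ?_⟩
  rw [← 𝓜.extension i, ObjectProperty.extensionProduct_iff]
  exact ⟨_, _, _, _, _, (someOctahedron rfl hA hB hC).mem, hA', hB'⟩

lemma IsCauchy.exists_trW [IsTriangulated S] {X : ℕ ⥤ S} (hX : 𝓜.IsCauchy X) (i : ℕ) :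
    ∃ N : ℕ, ∀ n m (f : n ⟶ m), N ≤ n → (𝓜.M i).trW (X.map f) := by
  obtain ⟨N, hN⟩ := hX i
  refine ⟨N, fun n m f hn ↦ ?_⟩
  obtain ⟨k, rfl⟩ := Nat.exists_eq_add_of_le (leOfHom f)
  induction k with
  | zero =>
    obtain rfl : f = 𝟙 n := Subsingleton.elim _ _
    rw [X.map_id]
    exact MorphismProperty.id_mem _ _
  | succ k ih =>
    have : f = homOfLE (Nat.le_add_right n k) ≫ homOfLE (Nat.le_succ (n + k)) :=
      Subsingleton.elim _ _
    rw [this, X.map_comp]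
    exact 𝓜.trW_comp i (ih _) (hN _ (by lia))

lemma IsCauchy.reindex [IsTriangulated S] {X : ℕ ⥤ S} (hX : 𝓜.IsCauchy X) (φ : ℕ ⥤ ℕ)
    (hφ : ∀ n, n ≤ φ.obj n) : 𝓜.IsCauchy (φ ⋙ X) := by
  intro i
  obtain ⟨N, hN⟩ := hX.exists_trW 𝓜 i
  exact ⟨N, fun n hn ↦ hN _ _ _ (hn.trans (hφ n))⟩

/-- A test presheaf of level `i` is cohomological and vanishes on `M i`. -/
structure IsTest (i : ℕ) (G : SMod S) : Prop where
  isCohomological : IsCohomological G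
  eq_zero (X : S) (hX : 𝓜.M i X) (s : (yon S).obj X ⟶ G) : s = 0

variable {𝓜}

lemma IsTest.mono {i j : ℕ} (hij : i ≤ j) {G : SMod S} (h : 𝓜.IsTest i G) : 𝓜.IsTest j G :=
  ⟨h.1, fun X hX ↦ h.2 X (𝓜.M_antitone hij X hX)⟩

lemma IsTest.shift {i : ℕ} {G : SMod S} (h : 𝓜.IsTest i G) (a : ℤ) :
    𝓜.IsTest (i + a.natAbs) (G⟦a⟧) := by
  refine ⟨h.1.shift a, fun X hX s ↦ (yonShiftHomEquiv a X G).injective ?_⟩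
  rw [map_zero]
  exact h.2 _ (𝓜.shift_int (-a) i X (by rwa [Int.natAbs_neg])) _

/-- Injectivity needs `G` to vanish on the cone, surjectivity on the cone shifted by `-1`; this is
the reason for the level `i + 1`. -/
lemma IsTest.bijective {i : ℕ} {G : SMod S} (h : 𝓜.IsTest i G) {X Y : S} {f : X ⟶ Y}
    (hf : (𝓜.M (i + 1)).trW f) :
    Function.Bijective (fun s : (yon S).obj Y ⟶ G ↦ (yon S).map f ≫ s) := by
  obtain ⟨Z, g, k, hT, hZ⟩ := hf
  refine ⟨?_, fun s ↦ ?_⟩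
  · refine (injective_iff_map_eq_zero (Preadditive.leftComp G ((yon S).map f))).2 fun s hs ↦ ?_
    obtain ⟨s', rfl⟩ := h.1 _ hT s hs
    exact (congrArg ((yon S).map g ≫ ·) (h.2 Z (𝓜.descending i Z hZ) s')).trans comp_zero
  · exact h.1.exact₁' hT s (h.2 (Z⟦(-1 : ℤ)⟧) (𝓜.shift_neg i Z hZ) _)

variable (𝓜)

/-- A morphism from a representable presheaf is an approximation of level `i` if it induces
bijections on morphisms to all test presheaves of level `i`. -/
def IsApprox (i : ℕ) {X : S} {F : SMod S} (a : (yon S).obj X ⟶ F) : Prop :=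
  ∀ G, 𝓜.IsTest i G → Function.Bijective (fun φ : F ⟶ G ↦ a ≫ φ)

variable {𝓜}

lemma IsApprox.mono {i j : ℕ} (hij : i ≤ j) {X : S} {F : SMod S} {a : (yon S).obj X ⟶ F}
    (h : 𝓜.IsApprox j a) : 𝓜.IsApprox i a :=
  fun G hG ↦ h G (hG.mono hij)

lemma IsApprox.hom_ext {i : ℕ} {X : S} {F : SMod S} {a : (yon S).obj X ⟶ F}
    (h : 𝓜.IsApprox i a) {G : SMod S} (hG : 𝓜.IsTest i G) {φ ψ : F ⟶ G}
    (hφ : a ≫ φ = a ≫ ψ) : φ = ψ :=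
  (h G hG).1 hφ

lemma IsApprox.exists_desc {i : ℕ} {X : S} {F : SMod S} {a : (yon S).obj X ⟶ F}
    (h : 𝓜.IsApprox i a) {G : SMod S} (hG : 𝓜.IsTest i G) (s : (yon S).obj X ⟶ G) :
    ∃ φ : F ⟶ G, a ≫ φ = s :=
  (h G hG).2 s

lemma IsApprox.comp {i : ℕ} {X Y : S} {F : SMod S} {a : (yon S).obj X ⟶ (yon S).obj Y}
    {b : (yon S).obj Y ⟶ F} (ha : 𝓜.IsApprox i a) (hb : 𝓜.IsApprox i b) :
    𝓜.IsApprox i (a ≫ b) := fun G hG ↦ by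
  have := (ha G hG).comp (hb G hG)
  simpa only [Function.comp_def, Category.assoc] using! this

lemma IsApprox.of_comp {i : ℕ} {X Y : S} {F : SMod S} {a : (yon S).obj X ⟶ (yon S).obj Y}
    {b : (yon S).obj Y ⟶ F} (hab : 𝓜.IsApprox i (a ≫ b)) (hb : 𝓜.IsApprox i b) :
    𝓜.IsApprox i a := fun G hG ↦ by
  rw [← Function.Bijective.of_comp_iff _ (hb G hG)]
  have := hab G hG
  simpa only [Function.comp_def, Category.assoc] using! this

lemma IsApprox.shift {i : ℕ} {X Y : S} {f : X ⟶ Y} (a : ℤ)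
    (h : 𝓜.IsApprox (i + a.natAbs) ((yon S).map f)) :
    𝓜.IsApprox i ((yon S).map (f⟦a⟧')) := fun G hG ↦ by
  rw [bijective_precomp_shift_iff (-a) a (by simp)]
  exact h _ (by simpa using hG.shift (-a))

/-- The five lemma also involves the shifts by `1` of the first two components, which costs one
level. -/
lemma IsApprox.third {i : ℕ} {T T' : Triangle S} (hT : T ∈ distTriang S) (hT' : T' ∈ distTriang S)
    (φ : T ⟶ T') (h₁ : 𝓜.IsApprox (i + 1) ((yon S).map φ.hom₁))
    (h₂ : 𝓜.IsApprox (i + 1) ((yon S).map φ.hom₂)) :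
    𝓜.IsApprox i ((yon S).map φ.hom₃) := fun G hG ↦
  hG.1.bijective₃ hT hT' φ (h₁ G (hG.mono (by lia))).1 (h₂ G (hG.mono (by lia)))
    (h₁.shift 1 G hG) (h₂.shift 1 G hG).2

/-- Maps from `F` to a test presheaf form the limit of the groups of maps from the terms of the
sequence, and this inverse system is eventually constant by `IsTest.bijective`. -/
lemma IsCauchy.exists_isApprox [IsTriangulated S] {X : ℕ ⥤ S} (hX : 𝓜.IsCauchy X) {F : SMod S}
    {ι : ∀ n, (yon S).obj (X.obj n) ⟶ F} (hι : IsIndLimit X F ι) (i : ℕ) :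
    ∃ N, ∀ n, N ≤ n → 𝓜.IsApprox i (ι n) := by
  obtain ⟨N, hN⟩ := hX.exists_trW 𝓜 (i + 1)
  refine ⟨N, fun n hn G hG ↦ ?_⟩
  have hb {m : ℕ} (f : n ⟶ m) := hG.bijective (hN n m f hn)
  refine ⟨fun φ ψ h ↦ hι.hom_ext fun m ↦ ?_, fun s ↦ ?_⟩
  · dsimp only at h
    rw [← hι.w (homOfLE (le_max_right n m)), Category.assoc, Category.assoc]
    congr 1
    refine (hb (homOfLE (le_max_left n m))).1 ?_
    dsimp only
    rw [reassoc_of% (hι.w (homOfLE (le_max_left n m))),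
      reassoc_of% (hι.w (homOfLE (le_max_left n m))), h]
  -- Extend `s` uniquely to stage `max n m` and restrict to stage `m`; uniqueness makes the
  -- restrictions compatible, including those with `m < n`.
  · choose t ht using fun m ↦ (hb (homOfLE (le_max_left n m))).2 s
    dsimp only at ht
    obtain ⟨φ, hφ⟩ := hι.exists_desc
      (fun m ↦ (yon S).map (X.map (homOfLE (le_max_right n m))) ≫ t m) (by
        intro m k f
        have e : t m = (yon S).map (X.map (homOfLE (max_le_max le_rfl (leOfHom f)))) ≫ t k := by
          refine (hb (homOfLE (le_max_left n m))).1 ?_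
          dsimp only
          rw [ht, ← Functor.map_comp_assoc, ← X.map_comp]
          exact (ht k).symm
        rw [e, ← Functor.map_comp_assoc, ← Functor.map_comp_assoc, ← X.map_comp, ← X.map_comp]
        rfl)
    refine ⟨φ, ?_⟩
    dsimp only
    rw [hφ, ← ht n]

lemma exists_isTest {F : SMod S} (hF : 𝓜.completionOf ⊤ F) : ∃ i, 𝓜.IsTest i F := by
  obtain ⟨⟨X, -, -, α, ⟨hα⟩⟩, j, hj⟩ := hF
  refine ⟨j, (IsIndLimit.of_isColimit hα).isCohomological, fun Y hY s ↦ (yonEquiv Y F).injective ?_⟩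
  have := AddCommGrpCat.subsingleton_of_isZero (hj Y hY)
  exact Subsingleton.elim _ _

lemma IsTest.compactlySupported {i : ℕ} {G : SMod S} (h : 𝓜.IsTest i G) :
    𝓜.compactlySupported G := by
  refine ⟨i, fun X hX ↦ ?_⟩
  have : Subsingleton (G.obj.obj (op X)) :=
    ⟨fun x y ↦ (yonEquiv X G).symm.injective ((h.2 X hX _).trans (h.2 X hX _).symm)⟩
  exact AddCommGrpCat.isZero_of_subsingleton _

lemma completionOf_of_isIndLimit {A : ObjectProperty S} {X : ℕ ⥤ S} (hX : 𝓜.IsCauchy X)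
    (hA : ∀ n, A (X.obj n)) {F : SMod S} {ι : ∀ n, (yon S).obj (X.obj n) ⟶ F}
    (hι : IsIndLimit X F ι) {i : ℕ} (hF : ∀ Y, 𝓜.M i Y → ∀ s : (yon S).obj Y ⟶ F, s = 0) :
    𝓜.completionOf A F :=
  ⟨⟨X, hX, hA, _, hι.isColimit⟩, IsTest.compactlySupported ⟨hι.isCohomological, hF⟩⟩

lemma exists_isIndLimit_of_completionOf {A : ObjectProperty S} {F : SMod S}
    (hF : 𝓜.completionOf A F) : ∃ X : ℕ ⥤ S, 𝓜.IsCauchy X ∧ (∀ n, A (X.obj n)) ∧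
      ∃ ι, IsIndLimit X F ι := by
  obtain ⟨⟨X, hX, hA, α, ⟨hα⟩⟩, -⟩ := hF
  exact ⟨X, hX, hA, _, IsIndLimit.of_isColimit hα⟩

end GoodMetric

end Approximation

/-! ### Lifting morphisms of colimits to morphisms of sequences. -/

section Lifting

variable {S : Type u} [Category.{v} S] [Preadditive S] [HasShift S ℤ]
  [∀ n : ℤ, (shiftFunctor S n).Additive]

/-- A morphism between colimits of representable presheaves lifts to a morphism of sequences, up to
reindexing the target. -/
lemma IsIndLimit.exists_lift {X Y : ℕ ⥤ S} {F G : SMod S}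
    {ι : ∀ n, (yon S).obj (X.obj n) ⟶ F} {κ : ∀ n, (yon S).obj (Y.obj n) ⟶ G}
    (hX : IsIndLimit X F ι) (hY : IsIndLimit Y G κ) (f : F ⟶ G) :
    ∃ (φ : ℕ ⥤ ℕ) (_ : ∀ n, n ≤ φ.obj n) (u : X ⟶ φ ⋙ Y),
      ∀ n, (yon S).map (u.app n) ≫ κ (φ.obj n) = ι n ≫ f := by
  -- A lift of `ι n ≫ f` to some stage `m ≥ n`; the inequality keeps the reindexing cofinal.
  let State (n : ℕ) := { p : Σ m, (X.obj n ⟶ Y.obj m) //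
    n ≤ p.1 ∧ (yon S).map p.2 ≫ κ p.1 = ι n ≫ f }
  have hstart : Nonempty (State 0) := by
    obtain ⟨m, g, hg⟩ := hY.exists_fac (ι 0 ≫ f)
    exact ⟨⟨⟨m, g⟩, Nat.zero_le _, hg⟩⟩
  have hstep (n : ℕ) (p : State n) : ∃ q : State (n + 1), ∃ h : p.1.1 ⟶ q.1.1,
      p.1.2 ≫ Y.map h = X.map (homOfLE (Nat.le_succ n)) ≫ q.1.2 := by
    obtain ⟨⟨k, g⟩, hk, hg⟩ := p
    obtain ⟨N, hN⟩ := hY.exists_fac_le (ι (n + 1) ≫ f)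
    obtain ⟨g', hg'⟩ := hN (max N (max k (n + 1))) (le_max_left _ _)
    -- The square between consecutive lifts commutes only in the colimit, hence after moving to a
    -- later stage.
    obtain ⟨m, j, hj⟩ := hY.exists_eq
      (g ≫ Y.map (homOfLE ((le_max_left k (n + 1)).trans (le_max_right N _))))
      (X.map (homOfLE (Nat.le_succ n)) ≫ g') (by
        rw [Functor.map_comp_assoc, hY.w, Functor.map_comp_assoc, hg']
        dsimp only at hg
        rw [hg, reassoc_of% (hX.w (homOfLE (Nat.le_succ n)))])
    refine ⟨⟨⟨m, g' ≫ Y.map j⟩, ?_, ?_⟩, homOfLE ((le_max_left k (n + 1)).trans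
      ((le_max_right N _).trans (leOfHom j))), ?_⟩
    · exact (le_max_right k (n + 1)).trans ((le_max_right N _).trans (leOfHom j))
    · change (yon S).map (g' ≫ Y.map j) ≫ κ m = _
      rw [Functor.map_comp_assoc, hY.w, hg']
    · dsimp only
      rw [← Category.assoc (X.map _), ← hj, Category.assoc, ← Y.map_comp]
      rfl
  choose next hle hnext using hstep
  let st (n : ℕ) : State n := Nat.rec hstart.some (fun n p ↦ next n p) n
  let φ : ℕ ⥤ ℕ := (monotone_nat_of_le_succ (f := fun n ↦ (st n).1.1)
    fun n ↦ leOfHom (hle n (st n))).functor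
  refine ⟨φ, fun n ↦ (st n).2.1, NatTrans.ofSequence (G := φ ⋙ Y) (fun n ↦ (st n).1.2)
    fun n ↦ (hnext n (st n)).symm, fun n ↦ (st n).2.2⟩

end Lifting

/-! ### Colimits of Cauchy sequences of distinguished triangles. -/

section Triangles

variable {S : Type u} [Category.{v} S] [Preadditive S] [HasZeroObject S] [HasShift S ℤ]
  [∀ n : ℤ, (shiftFunctor S n).Additive] [Pretriangulated S]

namespace GoodMetric

variable (𝓜 : GoodMetric S)

/-- A commutative square between the first maps of distinguished triangles extends to a morphism
of triangles whose third component has a small cone as soon as the first two do. -/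
lemma exists_hom₃ [IsTriangulated S] {X Y Z X' Y' Z' : S} {f : X ⟶ Y} {g : Y ⟶ Z}
    {h : Z ⟶ X⟦(1 : ℤ)⟧} {f' : X' ⟶ Y'} {g' : Y' ⟶ Z'} {h' : Z' ⟶ X'⟦(1 : ℤ)⟧}
    (hT : Triangle.mk f g h ∈ distTriang S) (hT' : Triangle.mk f' g' h' ∈ distTriang S)
    (a : X ⟶ X') (b : Y ⟶ Y') (comm : f ≫ b = a ≫ f') :
    ∃ c : Z ⟶ Z', g ≫ c = b ≫ g' ∧ h ≫ a⟦(1 : ℤ)⟧' = c ≫ h' ∧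
      ∀ i, (𝓜.M (i + 1)).trW a → (𝓜.M i).trW b → (𝓜.M i).trW c := by
  obtain ⟨A, a₂, a₃, hA⟩ := distinguished_cocone_triangle a
  obtain ⟨B, b₂, b₃, hB⟩ := distinguished_cocone_triangle b
  obtain ⟨W, k₂, k₃, hW⟩ := distinguished_cocone_triangle (f ≫ b)
  -- Both octahedra are built on the same composite, written as `f ≫ b` and as `a ≫ f'`. The third
  -- map is the composite of cone(f) ⟶ cone(f ≫ b) ⟶ cone(f'), whose factors have cones cone(b) and
  -- cone(a)[1]; the shift explains the extra level asked of `a`.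
  have o := someOctahedron rfl hT hB hW
  have o' := someOctahedron comm.symm hA hT' hW
  refine ⟨o.m₁ ≫ o'.m₃, ?_, ?_, fun i ha hb ↦ 𝓜.trW_comp i ⟨_, _, _, o.mem, ?_⟩
    ⟨_, _, _, rot_of_distTriang _ o'.mem, ?_⟩⟩
  · rw [o.comm₁_assoc, o'.comm₃]
  · rw [Category.assoc, ← o'.comm₄, o.comm₂_assoc]
  · exact (ObjectProperty.trW_iff_of_distinguished _ _ hB).1 hb
  · exact 𝓜.shift_pos i _ ((ObjectProperty.trW_iff_of_distinguished _ _ hA).1 ha)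

/-- The cones of a morphism of Cauchy sequences can be arranged in a Cauchy sequence. -/
lemma exists_cone [IsTriangulated S] {X Y : ℕ ⥤ S} (hX : 𝓜.IsCauchy X) (hY : 𝓜.IsCauchy Y)
    (u : X ⟶ Y) : ∃ (Z : ℕ ⥤ S) (v : Y ⟶ Z) (w : Z ⟶ X ⋙ shiftFunctor S (1 : ℤ)),
      𝓜.IsCauchy Z ∧ ∀ n, Triangle.mk (u.app n) (v.app n) (w.app n) ∈ distTriang S := by
  choose Z g h hT using fun n ↦ distinguished_cocone_triangle (u.app n)
  choose c hc₁ hc₂ hc using fun n ↦ 𝓜.exists_hom₃ (hT n) (hT (n + 1))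
    (X.map (homOfLE (Nat.le_succ n))) (Y.map (homOfLE (Nat.le_succ n)))
    (u.naturality (homOfLE (Nat.le_succ n))).symm
  refine ⟨Functor.ofSequence c,
    NatTrans.ofSequence (G := Functor.ofSequence c) g fun n ↦ ?_,
    NatTrans.ofSequence (F := Functor.ofSequence c) (G := X ⋙ shiftFunctor S (1 : ℤ)) h fun n ↦ ?_,
    fun i ↦ ?_, hT⟩
  · rw [Functor.ofSequence_map_homOfLE_succ]
    exact (hc₁ n).symm
  · rw [Functor.ofSequence_map_homOfLE_succ]
    exact (hc₂ n).symm
  · obtain ⟨N, hN⟩ := hX (i + 1)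
    obtain ⟨N', hN'⟩ := hY i
    refine ⟨max N N', fun n hn ↦ ?_⟩
    have : (Functor.ofSequence c).map (homOfLE (Nat.le_succ n)) = c n :=
      Functor.ofSequence_map_homOfLE_succ c n
    rw [this]
    exact hc n i (hN n ((le_max_left _ _).trans hn)) (hN' n ((le_max_right _ _).trans hn))

/-- A presentation of a triangle of presheaves as the colimit of a Cauchy sequence of distinguished
triangles. -/
structure IndTriangle (T : Triangle (SMod S)) where
  /-- the sequence of first objects -/
  X : ℕ ⥤ S
  /-- the sequence of second objects -/
  Y : ℕ ⥤ S
  /-- the sequence of third objects -/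
  Z : ℕ ⥤ S
  /-- the first morphisms -/
  u : X ⟶ Y
  /-- the second morphisms -/
  v : Y ⟶ Z
  /-- the third morphisms -/
  w : Z ⟶ X ⋙ shiftFunctor S (1 : ℤ)
  dist (n : ℕ) : Triangle.mk (u.app n) (v.app n) (w.app n) ∈ distTriang S
  cauchyX : 𝓜.IsCauchy X
  cauchyY : 𝓜.IsCauchy Y
  cauchyZ : 𝓜.IsCauchy Z
  /-- the maps to the first object of the colimit -/
  a (n : ℕ) : (yon S).obj (X.obj n) ⟶ T.obj₁
  /-- the maps to the second object of the colimit -/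
  b (n : ℕ) : (yon S).obj (Y.obj n) ⟶ T.obj₂
  /-- the maps to the third object of the colimit -/
  c (n : ℕ) : (yon S).obj (Z.obj n) ⟶ T.obj₃
  limitX : IsIndLimit X T.obj₁ a
  limitY : IsIndLimit Y T.obj₂ b
  limitZ : IsIndLimit Z T.obj₃ c
  comm₁ (n : ℕ) : (yon S).map (u.app n) ≫ b n = a n ≫ T.mor₁
  comm₂ (n : ℕ) : (yon S).map (v.app n) ≫ c n = b n ≫ T.mor₂
  comm₃ (n : ℕ) : (yon S).map (w.app n) ≫
    ((yon S).commShiftIso (1 : ℤ)).hom.app (X.obj n) ≫ (a n)⟦(1 : ℤ)⟧' = c n ≫ T.mor₃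

variable {𝓜}

namespace IndTriangle

variable {T : Triangle (SMod S)}

/-- The sequence of triangles underlying a presentation. -/
def functor (τ : 𝓜.IndTriangle T) : ℕ ⥤ Triangle S := Triangle.functorMk τ.u τ.v τ.w

/-- The maps to the colimit, as morphisms of triangles. -/
def hom (τ : 𝓜.IndTriangle T) (n : ℕ) : (yon S).mapTriangle.obj (τ.functor.obj n) ⟶ T :=
  Triangle.homMk _ _ (τ.a n) (τ.b n) (τ.c n) (τ.comm₁ n) (τ.comm₂ n)
    ((Category.assoc _ _ _).trans (τ.comm₃ n))

/-- A presentation constructed from a sequence of triangles. -/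
def ofFunctor (D : ℕ ⥤ Triangle S) (hD : ∀ n, D.obj n ∈ distTriang S)
    (h₁ : 𝓜.IsCauchy (D ⋙ Triangle.π₁)) (h₂ : 𝓜.IsCauchy (D ⋙ Triangle.π₂))
    (h₃ : 𝓜.IsCauchy (D ⋙ Triangle.π₃)) (α : ∀ n, (yon S).mapTriangle.obj (D.obj n) ⟶ T)
    (hα₁ : IsIndLimit (D ⋙ Triangle.π₁) T.obj₁ fun n ↦ (α n).hom₁)
    (hα₂ : IsIndLimit (D ⋙ Triangle.π₂) T.obj₂ fun n ↦ (α n).hom₂)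
    (hα₃ : IsIndLimit (D ⋙ Triangle.π₃) T.obj₃ fun n ↦ (α n).hom₃) : 𝓜.IndTriangle T where
  X := D ⋙ Triangle.π₁
  Y := D ⋙ Triangle.π₂
  Z := D ⋙ Triangle.π₃
  u := Functor.whiskerLeft D Triangle.π₁Toπ₂
  v := Functor.whiskerLeft D Triangle.π₂Toπ₃
  w := Functor.whiskerLeft D Triangle.π₃Toπ₁
  dist := hD
  cauchyX := h₁
  cauchyY := h₂
  cauchyZ := h₃
  a n := (α n).hom₁
  b n := (α n).hom₂
  c n := (α n).hom₃
  limitX := hα₁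
  limitY := hα₂
  limitZ := hα₃
  comm₁ n := (α n).comm₁
  comm₂ n := (α n).comm₂
  comm₃ n := (Category.assoc _ _ _).symm.trans (α n).comm₃

/-- Transport of a presentation along an isomorphism. -/
def ofIso (τ : 𝓜.IndTriangle T) {T' : Triangle (SMod S)} (e : T ≅ T') : 𝓜.IndTriangle T' :=
  ofFunctor τ.functor τ.dist τ.cauchyX τ.cauchyY τ.cauchyZ (fun n ↦ τ.hom n ≫ e.hom)
    (τ.limitX.of_iso_target (Triangle.π₁.mapIso e))
    (τ.limitY.of_iso_target (Triangle.π₂.mapIso e))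
    (τ.limitZ.of_iso_target (Triangle.π₃.mapIso e))

/-- The rotation of a presentation. -/
def rotate (τ : 𝓜.IndTriangle T) : 𝓜.IndTriangle T.rotate :=
  ofFunctor (τ.functor ⋙ Pretriangulated.rotate S) (fun n ↦ rot_of_distTriang _ (τ.dist n))
    τ.cauchyY τ.cauchyZ (τ.cauchyX.shift 𝓜 1)
    (fun n ↦ (yon S).mapTriangleRotateIso.inv.app _ ≫
      (Pretriangulated.rotate (SMod S)).map (τ.hom n))
    (τ.limitY.congr fun _ ↦ Category.id_comp _) (τ.limitZ.congr fun _ ↦ Category.id_comp _)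
    (τ.limitX.shift 1)

/-- The inverse rotation of a presentation. -/
noncomputable def invRotate (τ : 𝓜.IndTriangle T) : 𝓜.IndTriangle T.invRotate :=
  ofFunctor (τ.functor ⋙ Pretriangulated.invRotate S) (fun n ↦ inv_rot_of_distTriang _ (τ.dist n))
    (τ.cauchyZ.shift 𝓜 (-1)) τ.cauchyX τ.cauchyY
    (fun n ↦ (yon S).mapTriangleInvRotateIso.inv.app _ ≫
      (Pretriangulated.invRotate (SMod S)).map (τ.hom n))
    (τ.limitZ.shift (-1)) (τ.limitX.congr fun _ ↦ Category.id_comp _)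
    (τ.limitY.congr fun _ ↦ Category.id_comp _)

lemma nonempty_contractible {F Z : SMod S} (hF : 𝓜.completionOf ⊤ F) (hZ : IsZero Z) :
    Nonempty (𝓜.IndTriangle (Triangle.mk (𝟙 F) (0 : F ⟶ Z) 0)) := by
  obtain ⟨X, hX, -, ι, hι⟩ := exists_isIndLimit_of_completionOf hF
  have h0 : IsZero ((yon S).obj 0) := (yon S).map_isZero (isZero_zero S)
  exact ⟨{
    X := X
    Y := X
    Z := (Functor.const ℕ).obj 0
    u := 𝟙 X
    v := 0
    w := 0
    dist := fun n ↦ contractible_distinguished (X.obj n)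
    cauchyX := hX
    cauchyY := hX
    cauchyZ := 𝓜.isCauchy_const 0
    a := ι
    b := ι
    c := fun _ ↦ 0
    limitX := hι
    limitY := hι
    limitZ := ((IsIndLimit.const (0 : S)).of_iso_target (h0.iso hZ)).congr fun _ ↦ h0.eq_of_src _ _
    comm₁ := fun n ↦ (congrArg (· ≫ ι n) ((yon S).map_id _)).trans
      ((Category.id_comp _).trans (Category.comp_id _).symm)
    comm₂ := fun _ ↦ comp_zero.trans comp_zero.symm
    comm₃ := fun _ ↦ h0.eq_of_src _ _ }⟩

section

variable [IsTriangulated S]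

/-- A map from `P` in `M (i + 1)` to the third object vanishes in the shifted first object. At a
late stage it therefore factors through the second term of a triangle of `S`, and maps from `P` to
the second object vanish. -/
lemma isTest₃ (τ : 𝓜.IndTriangle T) {i : ℕ} (h₁ : 𝓜.IsTest i T.obj₁)
    (h₂ : 𝓜.IsTest i T.obj₂) : 𝓜.IsTest (i + 1) T.obj₃ := by
  refine ⟨τ.limitZ.isCohomological, fun P hP s ↦ ?_⟩
  obtain ⟨n, g, rfl⟩ := τ.limitZ.exists_fac s
  obtain ⟨m, f, hf⟩ := (τ.limitX.shift 1).exists_eq_zero (g ≫ τ.w.app n) (by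
    rw [Functor.map_comp_assoc, τ.comm₃]
    exact (h₁.shift 1).2 P hP _)
  obtain ⟨(k : P ⟶ τ.Y.obj m), hk⟩ := Triangle.coyoneda_exact₃ _ (τ.dist m) (g ≫ τ.Z.map f)
    ((Category.assoc _ _ _).trans ((congrArg (g ≫ ·) (τ.w.naturality f)).trans
      ((Category.assoc _ _ _).symm.trans hf)))
  replace hk : g ≫ τ.Z.map f = k ≫ τ.v.app m := hk
  rw [← τ.limitZ.w f, ← Functor.map_comp_assoc, hk, Functor.map_comp_assoc, τ.comm₂ m,
    ← Category.assoc, h₂.2 P (𝓜.descending i P hP) ((yon S).map k ≫ τ.b m), zero_comp]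

end

end IndTriangle

/-- Any morphism between objects of the completion lies in a colimit of a Cauchy sequence of
distinguished triangles lifting a given morphism of sequences. -/
lemma exists_indTriangle_of_lift [IsTriangulated S] {X Y : ℕ ⥤ S} (hX : 𝓜.IsCauchy X)
    (hY : 𝓜.IsCauchy Y) {F G : SMod S}
    {ι : ∀ n, (yon S).obj (X.obj n) ⟶ F} {κ : ∀ n, (yon S).obj (Y.obj n) ⟶ G}
    (hι : IsIndLimit X F ι) (hκ : IsIndLimit Y G κ) (u : X ⟶ Y) {f : F ⟶ G}
    (hf : ∀ n, (yon S).map (u.app n) ≫ κ n = ι n ≫ f)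
    (hF : 𝓜.completionOf ⊤ F) (hG : 𝓜.completionOf ⊤ G) :
    ∃ (H : SMod S) (_ : 𝓜.completionOf ⊤ H) (g : G ⟶ H) (h : H ⟶ F⟦(1 : ℤ)⟧)
      (Z : ℕ ⥤ S) (v : Y ⟶ Z) (w : Z ⟶ X ⋙ shiftFunctor S (1 : ℤ))
      (ξ : ∀ n, (yon S).obj (Z.obj n) ⟶ H), 𝓜.IsCauchy Z ∧
      (∀ n, Triangle.mk (u.app n) (v.app n) (w.app n) ∈ distTriang S) ∧ IsIndLimit Z H ξ ∧
      (∀ n, (yon S).map (v.app n) ≫ ξ n = κ n ≫ g) ∧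
      (∀ n, (yon S).map (w.app n) ≫ ((yon S).commShiftIso (1 : ℤ)).hom.app (X.obj n) ≫
        (ι n)⟦(1 : ℤ)⟧' = ξ n ≫ h) ∧
      Nonempty (𝓜.IndTriangle (Triangle.mk f g h)) := by
  obtain ⟨Z, v, w, hZ, hT⟩ := 𝓜.exists_cone hX hY u
  obtain ⟨H, ξ, hξ⟩ := exists_isIndLimit Z
  obtain ⟨g, hg⟩ := hκ.exists_desc (fun n ↦ (yon S).map (v.app n) ≫ ξ n) (fun {n m} f ↦ by
    rw [← Functor.map_comp_assoc, v.naturality, Functor.map_comp_assoc, hξ.w])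
  obtain ⟨h, hh⟩ := hξ.exists_desc (fun n ↦ (yon S).map (w.app n) ≫
      ((yon S).commShiftIso (1 : ℤ)).hom.app (X.obj n) ≫ (ι n)⟦(1 : ℤ)⟧') (fun {n m} f ↦ by
    rw [← Functor.map_comp_assoc, w.naturality, Functor.map_comp_assoc, (hι.shift 1).w])
  let τ : 𝓜.IndTriangle (Triangle.mk f g h) :=
    { X := X, Y := Y, Z := Z, u := u, v := v, w := w, dist := hT, cauchyX := hX, cauchyY := hY,
      cauchyZ := hZ, a := ι, b := κ, c := ξ, limitX := hι, limitY := hκ, limitZ := hξ,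
      comm₁ := hf, comm₂ := fun n ↦ (hg n).symm, comm₃ := fun n ↦ (hh n).symm }
  obtain ⟨i, hi⟩ := exists_isTest hF
  obtain ⟨j, hj⟩ := exists_isTest hG
  exact ⟨H, completionOf_of_isIndLimit hZ (fun _ ↦ trivial) hξ
    (τ.isTest₃ (hi.mono (le_max_left i j)) (hj.mono (le_max_right i j))).2,
    g, h, Z, v, w, ξ, hZ, hT, hξ, fun n ↦ (hg n).symm, fun n ↦ (hh n).symm, ⟨τ⟩⟩

lemma exists_indTriangle [IsTriangulated S] {F G : SMod S} (f : F ⟶ G)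
    (hF : 𝓜.completionOf ⊤ F) (hG : 𝓜.completionOf ⊤ G) :
    ∃ (H : SMod S) (_ : 𝓜.completionOf ⊤ H) (g : G ⟶ H) (h : H ⟶ F⟦(1 : ℤ)⟧),
      Nonempty (𝓜.IndTriangle (Triangle.mk f g h)) := by
  obtain ⟨X, hX, -, ι, hι⟩ := exists_isIndLimit_of_completionOf hF
  obtain ⟨Y, hY, -, κ, hκ⟩ := exists_isIndLimit_of_completionOf hG
  obtain ⟨φ, hφ, u, hu⟩ := hι.exists_lift hκ f
  obtain ⟨H, hH, g, h, Z, v, w, ξ, -, -, -, -, -, hτ⟩ := exists_indTriangle_of_lift hX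
    (hY.reindex 𝓜 φ hφ) hι (hκ.reindex φ hφ) u hu hF hG
  exact ⟨H, hH, g, h, hτ⟩

end GoodMetric

end Triangles

/-! ### Completion of morphisms and the octahedral axiom for colimit triangles. -/

section Axioms

variable {S : Type u} [Category.{v} S] [Preadditive S] [HasZeroObject S] [HasShift S ℤ]
  [∀ n : ℤ, (shiftFunctor S n).Additive] [Pretriangulated S] [IsTriangulated S]

namespace GoodMetric

variable {𝓜 : GoodMetric S}

lemma yon_commShift_naturality {X Y : S} (f : X ⟶ Y) (n : ℤ) :
    (yon S).map (f⟦n⟧') ≫ ((yon S).commShiftIso n).hom.app Y =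
      ((yon S).commShiftIso n).hom.app X ≫ ((yon S).map f)⟦n⟧' :=
  ((yon S).commShiftIso n).hom.naturality f

lemma yon_map_comp_shift {A A' C : S} (γ : C ⟶ A⟦(1 : ℤ)⟧) (x : A ⟶ A') {F : SMod S}
    (a : (yon S).obj A' ⟶ F) :
    (yon S).map (γ ≫ x⟦(1 : ℤ)⟧') ≫ ((yon S).commShiftIso (1 : ℤ)).hom.app A' ≫ a⟦(1 : ℤ)⟧' =
      (yon S).map γ ≫ ((yon S).commShiftIso (1 : ℤ)).hom.app A ≫
        ((yon S).map x ≫ a)⟦(1 : ℤ)⟧' := by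
  rw [Functor.map_comp_assoc, reassoc_of% yon_commShift_naturality x (1 : ℤ),
    CategoryTheory.Functor.map_comp]

/-- A commutative square from the first map of a distinguished triangle of `S` to the first map of
a colimit triangle extends to a morphism of triangles, preserving approximations. -/
lemma IndTriangle.exists_hom₃ {T : Triangle (SMod S)} (τ : 𝓜.IndTriangle T) {A B C : S}
    {α : A ⟶ B} {β : B ⟶ C} {γ : C ⟶ A⟦(1 : ℤ)⟧} (hT₀ : Triangle.mk α β γ ∈ distTriang S)
    (p : (yon S).obj A ⟶ T.obj₁) (q : (yon S).obj B ⟶ T.obj₂)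
    (hpq : (yon S).map α ≫ q = p ≫ T.mor₁) (i : ℕ) :
    ∃ r : (yon S).obj C ⟶ T.obj₃, (yon S).map β ≫ r = q ≫ T.mor₂ ∧
      (yon S).map γ ≫ ((yon S).commShiftIso (1 : ℤ)).hom.app A ≫ p⟦(1 : ℤ)⟧' =
        r ≫ T.mor₃ ∧
      (𝓜.IsApprox (i + 1) p → 𝓜.IsApprox (i + 1) q → 𝓜.IsApprox i r) := by
  obtain ⟨Na, ha⟩ := τ.cauchyX.exists_isApprox τ.limitX (i + 1)
  obtain ⟨Nb, hb⟩ := τ.cauchyY.exists_isApprox τ.limitY (i + 1)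
  obtain ⟨Nc, hc⟩ := τ.cauchyZ.exists_isApprox τ.limitZ (i + 1)
  obtain ⟨Np, hp⟩ := τ.limitX.exists_fac_le p
  obtain ⟨Nq, hq⟩ := τ.limitY.exists_fac_le q
  obtain ⟨N, h₁, h₂, h₃, h₄, h₅⟩ : ∃ N, Na ≤ N ∧ Nb ≤ N ∧ Nc ≤ N ∧ Np ≤ N ∧ Nq ≤ N :=
    ⟨Na + Nb + Nc + Np + Nq, by lia, by lia, by lia, by lia, by lia⟩
  obtain ⟨p', rfl⟩ := hp N h₄
  obtain ⟨q', rfl⟩ := hq N h₅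
  -- The lifted square commutes in the colimit, hence in `S` at a later stage `m`, where the axiom
  -- of `S` supplies the third map.
  obtain ⟨m, f, hf⟩ := τ.limitY.exists_eq (α ≫ q') (p' ≫ τ.u.app N) (by
    rw [Functor.map_comp_assoc, Functor.map_comp_assoc, hpq, Category.assoc, τ.comm₁])
  have hpq' : α ≫ q' ≫ τ.Y.map f = (p' ≫ τ.X.map f) ≫ τ.u.app m := by
    rw [← Category.assoc, hf, Category.assoc, Category.assoc, τ.u.naturality]
  obtain ⟨(r' : C ⟶ τ.Z.obj m), (hr₁ : β ≫ r' = (q' ≫ τ.Y.map f) ≫ τ.v.app m),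
    (hr₂ : γ ≫ (p' ≫ τ.X.map f)⟦(1 : ℤ)⟧' = r' ≫ τ.w.app m)⟩ :=
    complete_distinguished_triangle_morphism _ _ hT₀ (τ.dist m)
    (p' ≫ τ.X.map f) (q' ≫ τ.Y.map f) hpq'
  let φ : Triangle.mk α β γ ⟶ Triangle.mk (τ.u.app m) (τ.v.app m) (τ.w.app m) :=
    Triangle.homMk _ _ (p' ≫ τ.X.map f) (q' ≫ τ.Y.map f) r' hpq' hr₁ hr₂
  have hfm := leOfHom f
  have ep : (yon S).map p' ≫ τ.a N = (yon S).map (p' ≫ τ.X.map f) ≫ τ.a m := by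
    rw [Functor.map_comp_assoc, τ.limitX.w]
  have eq : (yon S).map q' ≫ τ.b N = (yon S).map (q' ≫ τ.Y.map f) ≫ τ.b m := by
    rw [Functor.map_comp_assoc, τ.limitY.w]
  refine ⟨(yon S).map r' ≫ τ.c m, ?_, ?_, fun hp hq ↦ ?_⟩
  · rw [← Functor.map_comp_assoc, hr₁, Functor.map_comp_assoc, τ.comm₂, ← Category.assoc, eq]
  · rw [Category.assoc, ← τ.comm₃, ← Functor.map_comp_assoc, ← hr₂, ep, yon_map_comp_shift]
  · rw [ep] at hp
    rw [eq] at hq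
    -- Cancelling the approximations at stage `m` makes the lifts of `p` and `q` approximations, so
    -- the five lemma applies to `φ`; composing with `τ.c m` returns to the colimit.
    exact (IsApprox.third hT₀ (τ.dist m) φ (hp.of_comp (ha m (by lia)))
      (hq.of_comp (hb m (by lia)))).comp ((hc m (by lia)).mono (by lia))

/-- A morphism between the first maps of colimit triangles extends to a morphism of triangles. -/
lemma IndTriangle.complete {T T' : Triangle (SMod S)} (τ : 𝓜.IndTriangle T)
    (τ' : 𝓜.IndTriangle T') (h₁ : 𝓜.completionOf ⊤ T'.obj₁) (h₂ : 𝓜.completionOf ⊤ T'.obj₂)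
    (f : T.obj₁ ⟶ T'.obj₁) (g : T.obj₂ ⟶ T'.obj₂) (hfg : T.mor₁ ≫ g = f ≫ T'.mor₁) :
    ∃ e : T.obj₃ ⟶ T'.obj₃, T.mor₂ ≫ e = g ≫ T'.mor₂ ∧ T.mor₃ ≫ f⟦(1 : ℤ)⟧' = e ≫ T'.mor₃ := by
  obtain ⟨i, hi⟩ := exists_isTest h₁
  obtain ⟨j, hj⟩ := exists_isTest h₂
  obtain ⟨k, hk₁, hk₃⟩ : ∃ k, 𝓜.IsTest k (T'.obj₁⟦(1 : ℤ)⟧) ∧ 𝓜.IsTest k T'.obj₃ :=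
    ⟨max i j + 1, (hi.mono (le_max_left i j)).shift 1,
      τ'.isTest₃ (hi.mono (le_max_left i j)) (hj.mono (le_max_right i j))⟩
  obtain ⟨Nb, hb⟩ := τ.cauchyY.exists_isApprox τ.limitY k
  obtain ⟨Nc, hc⟩ := τ.cauchyZ.exists_isApprox τ.limitZ k
  have hb := hb (max Nb Nc) (le_max_left _ _)
  have hc := hc (max Nb Nc) (le_max_right _ _)
  generalize max Nb Nc = n at hb hc
  -- Only stage `n` of `τ` is used: `r` extends along `τ.c n`, and both squares may be checked there
  -- because their targets are test presheaves. The level `0` is arbitrary, as `r` need not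
  -- approximate anything.
  obtain ⟨r, hr₁, hr₂, -⟩ := τ'.exists_hom₃ (τ.dist n) (τ.a n ≫ f) (τ.b n ≫ g) (by
    rw [← Category.assoc, τ.comm₁, Category.assoc, hfg, Category.assoc]) 0
  obtain ⟨e, rfl⟩ := hc.exists_desc hk₃ r
  refine ⟨e, hb.hom_ext hk₃ ?_, hc.hom_ext hk₁ ?_⟩
  · rw [← Category.assoc, ← τ.comm₂, Category.assoc, hr₁, Category.assoc]
  · rw [← Category.assoc, ← τ.comm₃, ← Category.assoc (τ.c n), ← hr₂, Functor.map_comp]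
    simp only [Category.assoc]

/-- A triangle that is sufficiently well approximated by a distinguished triangle of `S` is a
colimit of a Cauchy sequence of distinguished triangles. -/
lemma IndTriangle.of_isApprox {F G H : SMod S} {f : F ⟶ G} {g : G ⟶ H} {h : H ⟶ F⟦(1 : ℤ)⟧}
    (h₁ : 𝓜.completionOf ⊤ F) (h₂ : 𝓜.completionOf ⊤ G) {i : ℕ} (ht₁ : 𝓜.IsTest i F)
    (ht₂ : 𝓜.IsTest i G) (ht₃ : 𝓜.IsTest i H) {A B C : S}
    {α : A ⟶ B} {β : B ⟶ C} {γ : C ⟶ A⟦(1 : ℤ)⟧} (hT₀ : Triangle.mk α β γ ∈ distTriang S)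
    (p : (yon S).obj A ⟶ F) (q : (yon S).obj B ⟶ G) (r : (yon S).obj C ⟶ H)
    (hpq : (yon S).map α ≫ q = p ≫ f) (hqr : (yon S).map β ≫ r = q ≫ g)
    (hrp : (yon S).map γ ≫ ((yon S).commShiftIso (1 : ℤ)).hom.app A ≫ p⟦(1 : ℤ)⟧' = r ≫ h)
    (hp : 𝓜.IsApprox (i + 2) p) (hq : 𝓜.IsApprox (i + 2) q) (hr : 𝓜.IsApprox (i + 2) r) :
    Nonempty (𝓜.IndTriangle (Triangle.mk f g h)) := by
  -- Compare `H` with the third object of a genuine colimit triangle on `f`. Both are approximated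
  -- by `C`, so the two extensions are mutually inverse. As `H'` is a test presheaf of level `i +
  -- 1`, `s` must be an approximation of that level, which requires `i + 2` for `p` and `q`.
  obtain ⟨H', hH', g', h', ⟨τ⟩⟩ := exists_indTriangle f h₁ h₂
  have htH : 𝓜.IsTest (i + 1) H' := τ.isTest₃ ht₁ ht₂
  obtain ⟨(s : (yon S).obj C ⟶ H'), (hs₁ : (yon S).map β ≫ s = q ≫ g'),
    (hs₂ : (yon S).map γ ≫ ((yon S).commShiftIso (1 : ℤ)).hom.app A ≫ p⟦(1 : ℤ)⟧' = s ≫ h'),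
    hs⟩ :=
    τ.exists_hom₃ hT₀ p q hpq (i + 1)
  replace hs : 𝓜.IsApprox (i + 1) s := hs hp hq
  replace hr := hr.mono (show i + 1 ≤ i + 2 by lia)
  have ht₃' := ht₃.mono (show i ≤ i + 1 by lia)
  obtain ⟨e, he⟩ := hr.exists_desc htH s
  obtain ⟨e', he'⟩ := hs.exists_desc ht₃' r
  let E : H' ≅ H :=
    { hom := e'
      inv := e
      hom_inv_id := hs.hom_ext htH (by rw [reassoc_of% he', he, Category.comp_id])
      inv_hom_id := hr.hom_ext ht₃' (by rw [reassoc_of% he, he', Category.comp_id]) }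
  have e₁ : g' ≫ e' = g := hq.hom_ext (ht₃.mono (show i ≤ i + 2 by lia)) (by
    rw [← hqr, ← he', reassoc_of% hs₁])
  have e₂ : h' = e' ≫ h := hs.hom_ext (ht₁.shift 1) (by rw [reassoc_of% he', ← hs₂, hrp])
  refine ⟨τ.ofIso (Triangle.isoMk _ _ (Iso.refl _) (Iso.refl _) E
    ((Category.comp_id _).trans (Category.id_comp _).symm)
    (e₁.trans (Category.id_comp _).symm) ?_)⟩
  exact (congrArg (h' ≫ ·) ((shiftFunctor (SMod S) (1 : ℤ)).map_id F)).trans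
    ((Category.comp_id _).trans e₂)

/-- No compatible sequence of octahedra is needed: one octahedron at a late stage gives `m₁` and
`m₃` by extension along approximations. The identities are checked at that stage, and the last
triangle is a colimit triangle by `IndTriangle.of_isApprox`. -/
lemma exists_octahedron_of_lift {F G H : SMod S} {f : F ⟶ G} {g : G ⟶ H}
    (hF : 𝓜.completionOf ⊤ F) (hG : 𝓜.completionOf ⊤ G) (hH : 𝓜.completionOf ⊤ H) {X Y Z : ℕ ⥤ S}
    (hX : 𝓜.IsCauchy X) (hY : 𝓜.IsCauchy Y) (hZ : 𝓜.IsCauchy Z)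
    {a : ∀ n, (yon S).obj (X.obj n) ⟶ F} {b : ∀ n, (yon S).obj (Y.obj n) ⟶ G}
    {c : ∀ n, (yon S).obj (Z.obj n) ⟶ H} (ha : IsIndLimit X F a) (hb : IsIndLimit Y G b)
    (hc : IsIndLimit Z H c) (u₁₂ : X ⟶ Y) (u₂₃ : Y ⟶ Z)
    (hu₁₂ : ∀ n, (yon S).map (u₁₂.app n) ≫ b n = a n ≫ f)
    (hu₂₃ : ∀ n, (yon S).map (u₂₃.app n) ≫ c n = b n ≫ g) :
    ∃ (A B C : SMod S) (_ : 𝓜.completionOf ⊤ A) (_ : 𝓜.completionOf ⊤ B)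
      (_ : 𝓜.completionOf ⊤ C) (v₁₂ : G ⟶ A) (w₁₂ : A ⟶ F⟦(1 : ℤ)⟧) (v₂₃ : H ⟶ B)
      (w₂₃ : B ⟶ G⟦(1 : ℤ)⟧) (v₁₃ : H ⟶ C) (w₁₃ : C ⟶ F⟦(1 : ℤ)⟧) (m₁ : A ⟶ C) (m₃ : C ⟶ B),
      Nonempty (𝓜.IndTriangle (Triangle.mk f v₁₂ w₁₂)) ∧
      Nonempty (𝓜.IndTriangle (Triangle.mk g v₂₃ w₂₃)) ∧
      Nonempty (𝓜.IndTriangle (Triangle.mk (f ≫ g) v₁₃ w₁₃)) ∧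
      v₁₂ ≫ m₁ = g ≫ v₁₃ ∧ m₁ ≫ w₁₃ = w₁₂ ∧ v₁₃ ≫ m₃ = v₂₃ ∧ w₁₃ ≫ f⟦(1 : ℤ)⟧' = m₃ ≫ w₂₃ ∧
      Nonempty (𝓜.IndTriangle (Triangle.mk m₁ m₃ (w₂₃ ≫ v₁₂⟦(1 : ℤ)⟧'))) := by
  obtain ⟨A, hA, v₁₂, w₁₂, ZA, vA, wA, x, hZA, dA, hx, hvA, hwA, ⟨τA⟩⟩ :=
    exists_indTriangle_of_lift hX hY ha hb u₁₂ hu₁₂ hF hG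
  obtain ⟨B, hB, v₂₃, w₂₃, ZB, vB, wB, y, hZB, dB, hy, hvB, hwB, ⟨τB⟩⟩ :=
    exists_indTriangle_of_lift hY hZ hb hc u₂₃ hu₂₃ hG hH
  obtain ⟨C, hC, v₁₃, w₁₃, ZC, vC, wC, z, hZC, dC, hz, hvC, hwC, ⟨τC⟩⟩ :=
    exists_indTriangle_of_lift hX hZ ha hc (u₁₂ ≫ u₂₃) (f := f ≫ g) (fun n ↦ by
      rw [NatTrans.comp_app, Functor.map_comp_assoc, hu₂₃, reassoc_of% (hu₁₂ n)]) hF hH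
  obtain ⟨i, tF, tG, tA, tB, tC⟩ : ∃ i, 𝓜.IsTest i F ∧ 𝓜.IsTest i G ∧ 𝓜.IsTest i A ∧
      𝓜.IsTest i B ∧ 𝓜.IsTest i C := by
    obtain ⟨k₁, h₁⟩ := exists_isTest hF
    obtain ⟨k₂, h₂⟩ := exists_isTest hG
    obtain ⟨k₃, h₃⟩ := exists_isTest hA
    obtain ⟨k₄, h₄⟩ := exists_isTest hB
    obtain ⟨k₅, h₅⟩ := exists_isTest hC
    exact ⟨k₁ + k₂ + k₃ + k₄ + k₅, h₁.mono (by lia), h₂.mono (by lia), h₃.mono (by lia),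
      h₄.mono (by lia), h₅.mono (by lia)⟩
  obtain ⟨n, ab, ac, ax, ay, az⟩ : ∃ n, 𝓜.IsApprox (i + 2) (b n) ∧ 𝓜.IsApprox (i + 2) (c n) ∧
      𝓜.IsApprox (i + 2) (x n) ∧ 𝓜.IsApprox (i + 2) (y n) ∧ 𝓜.IsApprox (i + 2) (z n) := by
    obtain ⟨k₁, h₁⟩ := hY.exists_isApprox hb (i + 2)
    obtain ⟨k₂, h₂⟩ := hZ.exists_isApprox hc (i + 2)
    obtain ⟨k₃, h₃⟩ := hZA.exists_isApprox hx (i + 2)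
    obtain ⟨k₄, h₄⟩ := hZB.exists_isApprox hy (i + 2)
    obtain ⟨k₅, h₅⟩ := hZC.exists_isApprox hz (i + 2)
    exact ⟨k₁ + k₂ + k₃ + k₄ + k₅, h₁ _ (by lia), h₂ _ (by lia), h₃ _ (by lia),
      h₄ _ (by lia), h₅ _ (by lia)⟩
  obtain ⟨n₁, n₃, e₁, e₂, e₃, e₄, hO⟩ := someOctahedron rfl (dA n) (dB n) (dC n)
  have tA' := tA.mono (show i ≤ i + 2 by lia)
  have tB' := tB.mono (show i ≤ i + 2 by lia)
  have tC' := tC.mono (show i ≤ i + 2 by lia)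
  have tF' : 𝓜.IsTest (i + 2) (F⟦(1 : ℤ)⟧) := (tF.shift 1).mono (show i + 1 ≤ i + 2 by lia)
  have tG' : 𝓜.IsTest (i + 2) (G⟦(1 : ℤ)⟧) := (tG.shift 1).mono (show i + 1 ≤ i + 2 by lia)
  obtain ⟨m₁, hm₁⟩ := ax.exists_desc tC' ((yon S).map n₁ ≫ z n)
  obtain ⟨m₃, hm₃⟩ := az.exists_desc tB' ((yon S).map n₃ ≫ y n)
  refine ⟨A, B, C, hA, hB, hC, v₁₂, w₁₂, v₂₃, w₂₃, v₁₃, w₁₃, m₁, m₃, ⟨τA⟩, ⟨τB⟩, ⟨τC⟩,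
    ab.hom_ext tC' ?_, ax.hom_ext tF' ?_, ac.hom_ext tB' ?_, az.hom_ext tG' ?_,
    IndTriangle.of_isApprox hA hC tA tC tB hO (x n) (z n) (y n) hm₁.symm hm₃.symm ?_ ax az ay⟩
  · rw [← reassoc_of% (hvA n), hm₁, ← Functor.map_comp_assoc, e₁, ← reassoc_of% (hu₂₃ n), ← hvC,
      Functor.map_comp_assoc]
  · rw [reassoc_of% hm₁, ← hwC, ← Functor.map_comp_assoc, e₂, hwA]
  · rw [← reassoc_of% (hvC n), hm₃, ← Functor.map_comp_assoc, e₃, hvB]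
  · rw [← reassoc_of% (hwC n), ← Functor.map_comp, ← hu₁₂, Functor.map_comp,
      ← reassoc_of% yon_commShift_naturality (u₁₂.app n) (1 : ℤ), ← Functor.map_comp_assoc, e₄,
      Functor.map_comp_assoc,
      hwB, reassoc_of% hm₃]
  · rw [← reassoc_of% (hwB n), ← Functor.map_comp, ← hvA, ← yon_map_comp_shift]

/-- The octahedron axiom for colimits of Cauchy sequences of distinguished triangles. -/
lemma exists_octahedron {F G H : SMod S} (f : F ⟶ G) (g : G ⟶ H) (hF : 𝓜.completionOf ⊤ F)
    (hG : 𝓜.completionOf ⊤ G) (hH : 𝓜.completionOf ⊤ H) :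
    ∃ (A B C : SMod S) (_ : 𝓜.completionOf ⊤ A) (_ : 𝓜.completionOf ⊤ B)
      (_ : 𝓜.completionOf ⊤ C) (v₁₂ : G ⟶ A) (w₁₂ : A ⟶ F⟦(1 : ℤ)⟧) (v₂₃ : H ⟶ B)
      (w₂₃ : B ⟶ G⟦(1 : ℤ)⟧) (v₁₃ : H ⟶ C) (w₁₃ : C ⟶ F⟦(1 : ℤ)⟧) (m₁ : A ⟶ C) (m₃ : C ⟶ B),
      Nonempty (𝓜.IndTriangle (Triangle.mk f v₁₂ w₁₂)) ∧
      Nonempty (𝓜.IndTriangle (Triangle.mk g v₂₃ w₂₃)) ∧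
      Nonempty (𝓜.IndTriangle (Triangle.mk (f ≫ g) v₁₃ w₁₃)) ∧
      v₁₂ ≫ m₁ = g ≫ v₁₃ ∧ m₁ ≫ w₁₃ = w₁₂ ∧ v₁₃ ≫ m₃ = v₂₃ ∧ w₁₃ ≫ f⟦(1 : ℤ)⟧' = m₃ ≫ w₂₃ ∧
      Nonempty (𝓜.IndTriangle (Triangle.mk m₁ m₃ (w₂₃ ≫ v₁₂⟦(1 : ℤ)⟧'))) := by
  obtain ⟨X, hX, -, a, ha⟩ := exists_isIndLimit_of_completionOf hF
  obtain ⟨Y, hY, -, b, hb⟩ := exists_isIndLimit_of_completionOf hG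
  obtain ⟨Z, hZ, -, c, hc⟩ := exists_isIndLimit_of_completionOf hH
  obtain ⟨φ, hφ, u₁₂, hu₁₂⟩ := ha.exists_lift hb f
  obtain ⟨ψ, hψ, u₂₃, hu₂₃⟩ := (hb.reindex φ hφ).exists_lift hc g
  exact exists_octahedron_of_lift hF hG hH hX (hY.reindex 𝓜 φ hφ) (hZ.reindex 𝓜 ψ hψ) ha
    (hb.reindex φ hφ) (hc.reindex ψ hψ) u₁₂ u₂₃ hu₁₂ hu₂₃

end GoodMetric

end Axioms

/-! ### The triangulated structure on the completion. -/

section CompletionTriangles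

variable {S : Type u} [Category.{v} S] [Preadditive S] [HasZeroObject S] [HasShift S ℤ]
  [∀ n : ℤ, (shiftFunctor S n).Additive] [Pretriangulated S]

namespace GoodMetric

variable {𝓜 : GoodMetric S}

lemma completionOf_mono {A B : ObjectProperty S} (h : A ≤ B) :
    𝓜.completionOf A ≤ 𝓜.completionOf B := fun _ ⟨⟨X, hX, hA, hF⟩, hF'⟩ ↦
  ⟨⟨X, hX, fun n ↦ h _ (hA n), hF⟩, hF'⟩

instance (A : ObjectProperty S) : (𝓜.completionOf A).IsClosedUnderIsomorphisms where
  of_iso {F G} e hF := by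
    obtain ⟨X, hX, hA, ι, hι⟩ := exists_isIndLimit_of_completionOf hF
    obtain ⟨i, hi⟩ := exists_isTest (completionOf_mono le_top _ hF)
    exact completionOf_of_isIndLimit hX hA (hι.of_iso_target e) (i := i) fun Y hY s ↦ by
      rw [← cancel_mono e.inv, hi.2 Y hY (s ≫ e.inv), zero_comp]

/-- The inclusion of the completion into the category of additive presheaves. -/
abbrev inclusion (𝓜 : GoodMetric S) : 𝓜.Completion ⥤ SMod S := (𝓜.completionOf ⊤).ι

/-- A morphism to a shift, in the completion, as a morphism of presheaves. -/
noncomputable def toShift {X Y : 𝓜.Completion} (f : X ⟶ Y⟦(1 : ℤ)⟧) : X.obj ⟶ Y.obj⟦(1 : ℤ)⟧ :=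
  𝓜.inclusion.map f ≫ (𝓜.inclusion.commShiftIso (1 : ℤ)).hom.app Y

/-- A morphism of presheaves to a shift, as a morphism in the completion. -/
noncomputable def ofToShift {X Y : 𝓜.Completion} (f : X.obj ⟶ Y.obj⟦(1 : ℤ)⟧) : X ⟶ Y⟦(1 : ℤ)⟧ :=
  ObjectProperty.homMk (f ≫ (𝓜.inclusion.commShiftIso (1 : ℤ)).inv.app Y)

@[simp]
lemma toShift_ofToShift {X Y : 𝓜.Completion} (f : X.obj ⟶ Y.obj⟦(1 : ℤ)⟧) :
    toShift (ofToShift f) = f := by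
  change (f ≫ (𝓜.inclusion.commShiftIso (1 : ℤ)).inv.app Y) ≫
    (𝓜.inclusion.commShiftIso (1 : ℤ)).hom.app Y = f
  rw [Category.assoc, Iso.inv_hom_id_app]
  exact Category.comp_id f

lemma toShift_injective {X Y : 𝓜.Completion} {f g : X ⟶ Y⟦(1 : ℤ)⟧} (h : toShift f = toShift g) :
    f = g :=
  𝓜.inclusion.map_injective ((cancel_mono _).1 h)

lemma toShift_comp {X Y Z : 𝓜.Completion} (g : X ⟶ Y) (f : Y ⟶ Z⟦(1 : ℤ)⟧) :
    toShift (g ≫ f) = g.hom ≫ toShift f := by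
  unfold toShift
  rw [CategoryTheory.Functor.map_comp, Category.assoc]
  rfl

lemma toShift_comp_shift {X Y Z : 𝓜.Completion} (f : X ⟶ Y⟦(1 : ℤ)⟧) (g : Y ⟶ Z) :
    toShift (f ≫ g⟦(1 : ℤ)⟧') = toShift f ≫ g.hom⟦(1 : ℤ)⟧' := by
  unfold toShift
  rw [CategoryTheory.Functor.map_comp, Category.assoc, Category.assoc]
  exact congrArg (𝓜.inclusion.map f ≫ ·)
    ((𝓜.inclusion.commShiftIso (1 : ℤ)).hom.naturality g)

lemma mem_completionTriangles_iff (T : Triangle 𝓜.Completion) :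
    T ∈ 𝓜.completionTriangles ↔ Nonempty (𝓜.IndTriangle (𝓜.inclusion.mapTriangle.obj T)) := by
  constructor
  · rintro ⟨D, hD, h₁, h₂, h₃, α, ⟨c₁⟩, ⟨c₂⟩, ⟨c₃⟩⟩
    refine ⟨IndTriangle.ofFunctor D hD h₁ h₂ h₃ α.app ?_ ?_ ?_⟩
    · exact IsIndLimit.of_isColimit (X := D ⋙ Triangle.π₁) c₁
    · exact IsIndLimit.of_isColimit (X := D ⋙ Triangle.π₂) c₂
    · exact IsIndLimit.of_isColimit (X := D ⋙ Triangle.π₃) c₃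
  · rintro ⟨τ⟩
    refine ⟨τ.functor, τ.dist, τ.cauchyX, τ.cauchyY, τ.cauchyZ,
      { app := τ.hom, naturality := fun n m f ↦ ?_ }, ?_, ?_, ?_⟩
    · apply Triangle.hom_ext
      · exact (τ.limitX.w f).trans (Category.comp_id _).symm
      · exact (τ.limitY.w f).trans (Category.comp_id _).symm
      · exact (τ.limitZ.w f).trans (Category.comp_id _).symm
    · exact τ.limitX.isColimit
    · exact τ.limitY.isColimit
    · exact τ.limitZ.isColimit

lemma mem_completionTriangles_mk_iff {X Y Z : 𝓜.Completion} (f : X ⟶ Y) (g : Y ⟶ Z)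
    (h : Z ⟶ X⟦(1 : ℤ)⟧) : Triangle.mk f g h ∈ 𝓜.completionTriangles ↔
      Nonempty (𝓜.IndTriangle (Triangle.mk f.hom g.hom (toShift h))) :=
  mem_completionTriangles_iff _

lemma completionTriangles_of_iso {T T' : Triangle 𝓜.Completion} (e : T ≅ T')
    (hT : T ∈ 𝓜.completionTriangles) : T' ∈ 𝓜.completionTriangles := by
  rw [mem_completionTriangles_iff] at hT ⊢
  exact ⟨hT.some.ofIso (𝓜.inclusion.mapTriangle.mapIso e)⟩

variable [IsTriangulated S]

lemma exists_completionTriangle {X Y : 𝓜.Completion} (f : X ⟶ Y) :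
    ∃ (Z : 𝓜.Completion) (g : Y ⟶ Z) (h : Z ⟶ X⟦(1 : ℤ)⟧),
      Triangle.mk f g h ∈ 𝓜.completionTriangles := by
  obtain ⟨H, hH, g, h, hτ⟩ := exists_indTriangle f.hom X.property Y.property
  refine ⟨⟨H, hH⟩, ObjectProperty.homMk g, ofToShift h, ?_⟩
  rw [mem_completionTriangles_mk_iff, toShift_ofToShift]
  exact hτ

lemma contractible_mem_completionTriangles (X : 𝓜.Completion) :
    contractibleTriangle X ∈ 𝓜.completionTriangles := by
  refine (mem_completionTriangles_mk_iff (𝟙 X) (0 : X ⟶ 0) 0).2 ?_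
  have h : toShift (0 : (0 : 𝓜.Completion) ⟶ X⟦(1 : ℤ)⟧) = 0 :=
    (𝓜.inclusion.map_isZero (isZero_zero _)).eq_of_src _ _
  rw [h]
  exact IndTriangle.nonempty_contractible X.property (𝓜.inclusion.map_isZero (isZero_zero _))

lemma rotate_mem_completionTriangles {T : Triangle 𝓜.Completion}
    (hT : T ∈ 𝓜.completionTriangles) : T.rotate ∈ 𝓜.completionTriangles := by
  rw [mem_completionTriangles_iff] at hT ⊢
  exact ⟨hT.some.rotate.ofIso (𝓜.inclusion.mapTriangleRotateIso.app T)⟩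

lemma invRotate_mem_completionTriangles {T : Triangle 𝓜.Completion}
    (hT : T ∈ 𝓜.completionTriangles) : T.invRotate ∈ 𝓜.completionTriangles := by
  rw [mem_completionTriangles_iff] at hT ⊢
  exact ⟨hT.some.invRotate.ofIso (𝓜.inclusion.mapTriangleInvRotateIso.app T)⟩

lemma complete_completionTriangles {X Y Z X' Y' Z' : 𝓜.Completion} {u : X ⟶ Y} {v : Y ⟶ Z}
    {w : Z ⟶ X⟦(1 : ℤ)⟧} {u' : X' ⟶ Y'} {v' : Y' ⟶ Z'} {w' : Z' ⟶ X'⟦(1 : ℤ)⟧}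
    (hT : Triangle.mk u v w ∈ 𝓜.completionTriangles)
    (hT' : Triangle.mk u' v' w' ∈ 𝓜.completionTriangles)
    (a : X ⟶ X') (b : Y ⟶ Y') (comm : u ≫ b = a ≫ u') :
    ∃ c : Z ⟶ Z', v ≫ c = b ≫ v' ∧ w ≫ a⟦(1 : ℤ)⟧' = c ≫ w' := by
  rw [mem_completionTriangles_mk_iff] at hT hT'
  obtain ⟨(c : Z.obj ⟶ Z'.obj), (h₁ : v.hom ≫ c = b.hom ≫ v'.hom),
    (h₂ : toShift w ≫ a.hom⟦(1 : ℤ)⟧' = c ≫ toShift w')⟩ :=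
    hT.some.complete hT'.some X'.property Y'.property a.hom b.hom (congrArg (·.hom) comm)
  refine ⟨ObjectProperty.homMk c, 𝓜.inclusion.map_injective h₁, toShift_injective ?_⟩
  rw [toShift_comp_shift, h₂, toShift_comp]
  rfl

/-- The pretriangulated structure on the completion. -/
abbrev pretriangulated (𝓜 : GoodMetric S) : Pretriangulated 𝓜.Completion where
  distinguishedTriangles := 𝓜.completionTriangles
  isomorphic_distinguished _ hT _ e := completionTriangles_of_iso e.symm hT
  contractible_distinguished := contractible_mem_completionTriangles
  distinguished_cocone_triangle := exists_completionTriangle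
  rotate_distinguished_triangle T :=
    ⟨rotate_mem_completionTriangles, fun hT ↦ completionTriangles_of_iso
      (rotCompInvRot.symm.app T) (invRotate_mem_completionTriangles hT)⟩
  complete_distinguished_triangle_morphism _ _ hT hT' a b comm :=
    complete_completionTriangles hT hT' a b comm

lemma isTriangulated (𝓜 : GoodMetric S) :
    let := 𝓜.pretriangulated
    IsTriangulated 𝓜.Completion := by
  let := 𝓜.pretriangulated
  -- It suffices to find an octahedron for one choice of the three cones of each composable pair.
  refine IsTriangulated.mk' fun X Y Z f g ↦ ?_
  obtain ⟨A, B, C, hA, hB, hC, v₁₂, w₁₂, v₂₃, w₂₃, v₁₃, w₁₃, m₁, m₃, h₁₂, h₂₃, h₁₃, e₁, e₂, e₃, e₄,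
    hO⟩ := exists_octahedron f.hom g.hom X.property Y.property Z.property
  refine ⟨X, Y, Z, ⟨A, hA⟩, ⟨B, hB⟩, ⟨C, hC⟩, f, g, Iso.refl _, Iso.refl _, Iso.refl _,
    (Category.comp_id _).trans (Category.id_comp _).symm,
    (Category.comp_id _).trans (Category.id_comp _).symm,
    ObjectProperty.homMk v₁₂, ofToShift w₁₂, ?_, ObjectProperty.homMk v₂₃, ofToShift w₂₃, ?_,
    ObjectProperty.homMk v₁₃, ofToShift w₁₃, ?_, ⟨{
      m₁ := ObjectProperty.homMk m₁
      m₃ := ObjectProperty.homMk m₃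
      comm₁ := 𝓜.inclusion.map_injective e₁
      comm₂ := toShift_injective ?_
      comm₃ := 𝓜.inclusion.map_injective e₃
      comm₄ := toShift_injective ?_
      mem := ?_ }⟩⟩
  · refine (mem_completionTriangles_mk_iff _ _ _).2 ?_
    rwa [toShift_ofToShift]
  · refine (mem_completionTriangles_mk_iff _ _ _).2 ?_
    rwa [toShift_ofToShift]
  · refine (mem_completionTriangles_mk_iff _ _ _).2 ?_
    rwa [toShift_ofToShift]
  · rwa [toShift_comp, toShift_ofToShift, toShift_ofToShift]
  · rwa [toShift_comp_shift, toShift_comp, toShift_ofToShift, toShift_ofToShift]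
  · refine (mem_completionTriangles_mk_iff _ _ _).2 ?_
    rwa [toShift_comp_shift, toShift_ofToShift]

end GoodMetric

end CompletionTriangles

/-! ### The t-structure on the completion. -/

section ExtendableTStructure

variable {S : Type u} [Category.{v} S] [Preadditive S] [HasZeroObject S] [HasShift S ℤ]
  [∀ n : ℤ, (shiftFunctor S n).Additive] [Pretriangulated S]

lemma IsIndLimit.isIso {X : ℕ ⥤ S} {F : SMod S} {ι : ∀ n, (yon S).obj (X.obj n) ⟶ F}
    (h : IsIndLimit X F ι) (N : ℕ) (hN : ∀ (m : ℕ) (f : N ⟶ m), IsIso (X.map f)) :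
    IsIso (ι N) := by
  refine isIso_of_bijective _ fun Y ↦ ⟨fun s s' hs ↦ ?_, fun s ↦ ?_⟩
  · obtain ⟨g, rfl⟩ := (yon S).map_surjective s
    obtain ⟨g', rfl⟩ := (yon S).map_surjective s'
    obtain ⟨m, f, hf⟩ := h.exists_eq g g' hs
    have := hN m f
    rw [(cancel_mono (X.map f)).1 hf]
  · obtain ⟨M, hM⟩ := h.exists_fac_le s
    obtain ⟨g, hg⟩ := hM (max N M) (le_max_right _ _)
    have := hN _ (homOfLE (le_max_left N M))
    refine ⟨(yon S).map (g ≫ inv (X.map (homOfLE (le_max_left N M)))), ?_⟩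
    dsimp only
    rw [← hg, ← h.w (homOfLE (le_max_left N M)), ← Functor.map_comp_assoc, Category.assoc,
      IsIso.inv_hom_id, Category.comp_id]

namespace GoodMetric

variable {𝓜 : GoodMetric S} {t : TStructure S}

lemma IsExtendable.exists_le (ht : 𝓜.IsExtendable t) (n : ℤ) : ∃ k, 𝓜.M k ≤ t.le n := by
  obtain ⟨k, hk⟩ := ht
  refine ⟨k + n.natAbs, fun X hX ↦ ?_⟩
  have : t.IsLE (X⟦n⟧) 0 := ⟨hk _ (𝓜.shift_int n k X hX)⟩
  exact (t.isLE_of_shift X n n 0).le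

/-- Some `M k` lies in `t.le (n - 1)`, which is left orthogonal to `X`. -/
lemma IsExtendable.exists_isTest (ht : 𝓜.IsExtendable t) {n : ℤ} {X : S} (hX : t.ge n X) :
    ∃ i, 𝓜.IsTest i ((yon S).obj X) := by
  obtain ⟨k, hk⟩ := ht.exists_le (n - 1)
  refine ⟨k, (IsIndLimit.const X).isCohomological, fun Y hY s ↦ ?_⟩
  obtain ⟨g, rfl⟩ := (yon S).map_surjective s
  rw [t.zero_of_isLE_of_isGE g (n - 1) n (by lia) ⟨hk Y hY⟩ ⟨hX⟩, Functor.map_zero]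

lemma IsExtendable.completionOf_yon (ht : 𝓜.IsExtendable t) {A : ObjectProperty S} {n : ℤ} {X : S}
    (hA : A X) (hX : t.ge n X) : 𝓜.completionOf A ((yon S).obj X) := by
  obtain ⟨i, hi⟩ := ht.exists_isTest hX
  exact completionOf_of_isIndLimit (𝓜.isCauchy_const X) (fun _ ↦ hA) (IsIndLimit.const X) hi.2

variable [IsTriangulated S]

/-- Late transition maps of a Cauchy sequence in `t.ge n` have zero cone, so the colimit is
represented by a term of the sequence, which lies in `A` itself. -/
lemma IsExtendable.exists_yon_iso (ht : 𝓜.IsExtendable t) {A : ObjectProperty S} {n : ℤ}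
    (hA : A ≤ t.ge n) {F : SMod S} (hF : 𝓜.completionOf A F) :
    ∃ X, A X ∧ Nonempty ((yon S).obj X ≅ F) := by
  obtain ⟨X, hX, hXA, ι, hι⟩ := exists_isIndLimit_of_completionOf hF
  -- The cone of a map between objects of `t.ge n` is only in `t.ge (n - 1)`, because of the shift,
  -- so it has to be forced into `t.le (n - 2)`.
  obtain ⟨k, hk⟩ := ht.exists_le (n - 2)
  obtain ⟨N, hN⟩ := hX.exists_trW 𝓜 k
  have := hι.isIso N fun m f ↦ by
    obtain ⟨Z, g, h, hT, hZ⟩ := hN N m f le_rfl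
    refine (Triangle.isZero₃_iff_isIso₁ _ hT).1 ?_
    have : t.IsGE (X.obj N) n := ⟨hA _ (hXA N)⟩
    have : t.IsGE (X.obj m) n := ⟨hA _ (hXA m)⟩
    have : t.IsLE Z (n - 2) := ⟨hk Z hZ⟩
    have : t.IsGE Z (n - 1) := t.isGE₂ _ (rot_of_distTriang _ hT) (n - 1)
      (t.isGE_of_ge (X.obj m) (n - 1) n) (t.isGE_shift (X.obj N) n 1 (n - 1))
    exact t.isZero Z (n - 2) (n - 1)
  exact ⟨X.obj N, hXA N, ⟨asIso (ι N)⟩⟩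

lemma IsExtendable.hom_eq_zero (ht : 𝓜.IsExtendable t) {F G : SMod S}
    (hF : 𝓜.completionOf (t.le 0) F) (hG : 𝓜.completionOf (t.ge 1) G) (f : F ⟶ G) : f = 0 := by
  obtain ⟨X, -, hX, ι, hι⟩ := exists_isIndLimit_of_completionOf hF
  obtain ⟨Y, hY, ⟨e⟩⟩ := ht.exists_yon_iso le_rfl hG
  refine hι.hom_ext fun n ↦ ?_
  obtain ⟨g, hg⟩ := (yon S).map_surjective (ι n ≫ f ≫ e.inv)
  rw [t.zero' g (hX n) hY, Functor.map_zero] at hg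
  rw [← cancel_mono e.inv, Category.assoc, ← hg, comp_zero, zero_comp]

lemma completionOf_shift {A B : ObjectProperty S} {a : ℤ} (h : ∀ X, A X → B (X⟦a⟧)) {F : SMod S}
    (hF : 𝓜.completionOf A F) : 𝓜.completionOf B (F⟦a⟧) := by
  obtain ⟨X, hX, hA, ι, hι⟩ := exists_isIndLimit_of_completionOf hF
  obtain ⟨i, hi⟩ := GoodMetric.exists_isTest (completionOf_mono le_top _ hF)
  exact completionOf_of_isIndLimit (hX.shift 𝓜 a) (fun n ↦ h _ (hA n)) (hι.shift a)
    (hi.shift a).2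

lemma inCompletion_shift {A B : ObjectProperty S} {a : ℤ} (h : ∀ X, A X → B (X⟦a⟧))
    {F : 𝓜.Completion} (hF : 𝓜.inCompletion A F) : 𝓜.inCompletion B (F⟦a⟧) :=
  (𝓜.completionOf B).prop_of_iso ((𝓜.inclusion.commShiftIso a).symm.app F)
    (completionOf_shift h hF)

instance (A : ObjectProperty S) : (𝓜.inCompletion A).IsClosedUnderIsomorphisms := by
  unfold inCompletion
  infer_instance

/-- The objects of a cone of a morphism to a constant sequence stay in the aisle, if the morphism
is a truncation at the start of the sequence. -/
lemma isLE_cone (t : TStructure S) {n : ℤ} {X X' B A C Z : S} {x : X ⟶ X'} {c : X' ⟶ C}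
    {c' : C ⟶ X⟦(1 : ℤ)⟧} {a : A ⟶ X} {b : X ⟶ B} {b' : B ⟶ A⟦(1 : ℤ)⟧} {u : X' ⟶ B} {v : B ⟶ Z}
    {w : Z ⟶ X'⟦(1 : ℤ)⟧} (hx : Triangle.mk x c c' ∈ distTriang S)
    (hab : Triangle.mk a b b' ∈ distTriang S) (hu : Triangle.mk u v w ∈ distTriang S)
    (comm : x ≫ u = b) (hC : t.IsLE C n) (hA : t.IsLE A n) : t.IsLE Z (n - 1) := by
  -- The octahedron on `x ≫ u = b` makes `Z` an extension of `C⟦1⟧` by `A⟦1⟧`.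
  have o := someOctahedron comm hx hu (rot_of_distTriang _ hab)
  exact t.isLE₂ _ (rot_of_distTriang _ o.mem) (n - 1) (t.isLE_shift A n 1 (n - 1))
    (t.isLE_shift C n 1 (n - 1))

/-- The coaisle part of `F` is represented by that of one late term. It suffices to map `F` to it
and to see that the cone is a Cauchy colimit of objects of `t.le (-1)`; the inverse rotation is then
the truncation triangle. -/
lemma IsExtendable.exists_triangle (ht : 𝓜.IsExtendable t) (F : 𝓜.Completion) :
    ∃ (A B : 𝓜.Completion) (_ : 𝓜.inCompletion (t.le 0) A) (_ : 𝓜.inCompletion (t.ge 1) B)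
      (f : A ⟶ F) (g : F ⟶ B) (h : B ⟶ A⟦(1 : ℤ)⟧),
      Triangle.mk f g h ∈ 𝓜.completionTriangles := by
  obtain ⟨X, hX, -, ι, hι⟩ := exists_isIndLimit_of_completionOf F.property
  obtain ⟨k, hk⟩ := ht
  obtain ⟨N₁, hN₁⟩ := hX.exists_trW 𝓜 k
  have htest (B : S) (hB : t.ge 1 B) : 𝓜.IsTest k ((yon S).obj B) := by
    refine ⟨(IsIndLimit.const B).isCohomological, fun Y hY s ↦ ?_⟩
    obtain ⟨g, rfl⟩ := (yon S).map_surjective s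
    rw [t.zero' g (hk Y hY) hB, Functor.map_zero]
  obtain ⟨N₂, hN₂⟩ := hX.exists_isApprox hι k
  obtain ⟨N, h₁, h₂⟩ : ∃ N, N₁ ≤ N ∧ N₂ ≤ N := ⟨max N₁ N₂, le_max_left _ _, le_max_right _ _⟩
  obtain ⟨A, B, hA, hB, a, b, b', hab⟩ := t.exists_triangle_zero_one (X.obj N)
  -- The truncation map of the single term `X N` extends to `F` because `B` represents a test
  -- presheaf.
  obtain ⟨g, hg⟩ := (hN₂ N h₂).exists_desc (htest B hB) ((yon S).map b)
  let φ : ℕ ⥤ ℕ := (show Monotone fun n ↦ N + n from fun _ _ h ↦ by dsimp; lia).functor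
  have hφ (n : ℕ) : n ≤ φ.obj n := Nat.le_add_left n N
  choose u hu using fun n ↦ (yon S).map_surjective (ι (φ.obj n) ≫ g)
  let u' : φ ⋙ X ⟶ (Functor.const ℕ).obj B :=
    { app := u
      naturality := fun n m f ↦ (yon S).map_injective (by
        refine ((yon S).map_comp _ _).trans ?_
        rw [hu]
        refine Eq.trans ?_ ((hu n).symm.trans
          (congrArg (yon S).map (Category.comp_id (u n)).symm))
        exact (Category.assoc _ _ _).symm.trans (congrArg (· ≫ g) ((hι.reindex φ hφ).w f))) }
  have hyB : 𝓜.completionOf (t.ge 1) ((yon S).obj B) :=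
    IsExtendable.completionOf_yon ⟨k, hk⟩ hB hB
  have hyB' := completionOf_mono le_top _ hyB
  obtain ⟨H, hH, v, w, Z, v', w', ξ, hZ, hT, hξ, -, -, hτ⟩ :=
    exists_indTriangle_of_lift (hX.reindex 𝓜 φ hφ) (𝓜.isCauchy_const B) (hι.reindex φ hφ)
      (IsIndLimit.const B) u' (f := g) (fun n ↦ (Category.comp_id _).trans (hu n)) F.property hyB'
  have hZle (n : ℕ) : t.le (-1) (Z.obj n) := by
    have hn : N ≤ φ.obj n := Nat.le_add_right N n
    obtain ⟨C, c, c', hC, hC'⟩ := hN₁ N (φ.obj n) (homOfLE hn) h₁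
    -- Here `A` is the aisle part of `X N`, and the cone `C` of the transition map lies in `M k`,
    -- hence in `t.le 0`.
    refine (isLE_cone t hC hab (hT n) ?_ ⟨hk C hC'⟩ ⟨hA⟩).le
    refine (yon S).map_injective ?_
    rw [Functor.map_comp, ← hg]
    refine (congrArg (_ ≫ ·) (hu n)).trans ?_
    rw [← Category.assoc, hι.w]
  have hHle : 𝓜.completionOf (t.le (-1)) H := by
    obtain ⟨i, hi⟩ := GoodMetric.exists_isTest hH
    exact completionOf_of_isIndLimit hZ hZle hξ hi.2
  have hdist : Triangle.mk (ObjectProperty.homMk g : F ⟶ ⟨_, hyB'⟩)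
      (ObjectProperty.homMk v : _ ⟶ (⟨H, hH⟩ : 𝓜.Completion)) (ofToShift w) ∈
        𝓜.completionTriangles := by
    rw [mem_completionTriangles_mk_iff, toShift_ofToShift]
    exact hτ
  have hHle' : 𝓜.inCompletion (t.le (-1)) (⟨H, hH⟩ : 𝓜.Completion) := hHle
  have hB' : 𝓜.inCompletion (t.ge 1) (⟨_, hyB'⟩ : 𝓜.Completion) := hyB
  exact ⟨_, _, inCompletion_shift (fun Y hY ↦ t.le_shift (-1) (-1) 0 (by lia) Y hY) hHle', hB',
    _, _, _, invRotate_mem_completionTriangles hdist⟩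

/-- The t-structure on the completion induced by an extendable t-structure. -/
abbrev IsExtendable.tStructure (ht : 𝓜.IsExtendable t) :
    letI := 𝓜.pretriangulated
    TStructure 𝓜.Completion :=
  letI := 𝓜.pretriangulated
  { le := fun n ↦ 𝓜.inCompletion (t.le n)
    ge := fun n ↦ 𝓜.inCompletion (t.ge n)
    le_shift := fun n a n' h _ hF ↦ inCompletion_shift (t.le_shift n a n' h) hF
    ge_shift := fun n a n' h _ hF ↦ inCompletion_shift (t.ge_shift n a n' h) hF
    zero' := fun _ _ f hF hG ↦ 𝓜.inclusion.map_injective (ht.hom_eq_zero hF hG f.hom)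
    le_zero_le := fun _ hF ↦ completionOf_mono t.le_zero_le _ hF
    ge_one_le := fun _ hF ↦ completionOf_mono t.ge_one_le _ hF
    exists_triangle_zero_one := ht.exists_triangle }

end GoodMetric

end ExtendableTStructure

/-! ### The heart is abelian. -/

section Heart

variable {C : Type u} [Category.{v} C] [Preadditive C] [HasZeroObject C] [HasShift C ℤ]
  [∀ n : ℤ, (shiftFunctor C n).Additive] [Pretriangulated C] (t : TStructure C)

lemma heart_hom_shift_eq_zero ⦃X Y : t.heart.FullSubcategory⦄ ⦃n : ℤ⦄
    (f : t.heart.ι.obj X ⟶ (t.heart.ι.obj Y)⟦n⟧) (hn : n < 0) : f = 0 := by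
  have : t.IsGE Y.obj 0 := ⟨Y.property.2⟩
  exact t.zero_of_isLE_of_isGE f 0 (-n) (by lia) ⟨X.property.1⟩ (t.isGE_shift Y.obj 0 n (-n))

/-- The cone of a map in the heart lives in degrees `-1` and `0`; its truncation triangle exhibits
the kernel, shifted by `1`, and the cokernel. With the vanishing of negative extensions this is the
criterion for the heart to be abelian. -/
lemma heart_admissibleMorphism : AbelianSubcategory.admissibleMorphism t.heart.ι = ⊤ := by
  ext X₁ X₂ f
  refine iff_of_true (fun Z g h hT ↦ ?_) trivial
  have h₁ : t.IsLE X₁.obj 0 := ⟨X₁.property.1⟩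
  have h₁' : t.IsGE X₁.obj 0 := ⟨X₁.property.2⟩
  have h₂ : t.IsLE X₂.obj 0 := ⟨X₂.property.1⟩
  have h₂' : t.IsGE X₂.obj 0 := ⟨X₂.property.2⟩
  have hZ : t.IsLE Z 0 := by
    have := t.isLE_shift X₁.obj 0 1 (-1)
    exact t.isLE₂ _ (rot_of_distTriang _ hT) 0 h₂ (t.isLE_of_le (X₁.obj⟦(1 : ℤ)⟧) (-1) 0)
  have hZ' : t.IsGE Z (-1) := t.isGE₂ _ (rot_of_distTriang _ hT) (-1)
    (t.isGE_of_ge X₂.obj (-1) 0) (t.isGE_shift X₁.obj 0 1 (-1))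
  obtain ⟨A, B, hA, hB, a, b, c, hab⟩ := t.exists_triangle Z (-1) 0 (by lia)
  have hA₁ : t.IsLE A (-1) := ⟨hA⟩
  have hB₁ : t.IsGE B 0 := ⟨hB⟩
  have hA₂ : t.IsGE A (-1) := by
    have := t.isGE_shift B 0 (-1) 1
    exact t.isGE₂ _ (inv_rot_of_distTriang _ hab) (-1) (t.isGE_of_ge (B⟦(-1 : ℤ)⟧) (-1) 1) hZ'
  have hB₂ : t.IsLE B 0 := by
    have := t.isLE_shift A (-1) 1 (-2)
    exact t.isLE₂ _ (rot_of_distTriang _ hab) 0 hZ (t.isLE_of_le (A⟦(1 : ℤ)⟧) (-2) 0)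
  let e : A⟦(-1 : ℤ)⟧⟦(1 : ℤ)⟧ ≅ A := (shiftFunctorCompIsoId C (-1 : ℤ) 1 (by lia)).app A
  refine ⟨⟨A⟦(-1 : ℤ)⟧, (t.isLE_shift A (-1) (-1) 0).le, (t.isGE_shift A (-1) (-1) 0).ge⟩,
    ⟨B, hB₂.le, hB⟩, e.hom ≫ a, b, c ≫ e.inv⟦(1 : ℤ)⟧', ?_⟩
  refine isomorphic_distinguished _ hab _ (Triangle.isoMk _ _ e (Iso.refl _) (Iso.refl _)
    (Category.comp_id _) ((Category.comp_id b).trans (Category.id_comp b).symm) ?_)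
  have he : e.inv⟦(1 : ℤ)⟧' ≫ e.hom⟦(1 : ℤ)⟧' = 𝟙 (A⟦(1 : ℤ)⟧) := by
    rw [← Functor.map_comp, e.inv_hom_id, CategoryTheory.Functor.map_id]
  exact (Category.assoc _ _ _).trans ((congrArg (c ≫ ·) he).trans
    ((Category.comp_id c).trans (Category.id_comp c).symm))

instance : t.heart.IsClosedUnderBinaryProducts where
  limitsOfShape_le := by
    rintro X ⟨p⟩
    have hl := p.prop_diag_obj (.mk .left)
    have hr := p.prop_diag_obj (.mk .right)
    have hT := binaryProductTriangle_distinguished (p.diag.obj (.mk .left))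
      (p.diag.obj (.mk .right))
    have e : (p.diag.obj (.mk .left) ⨯ p.diag.obj (.mk .right)) ≅ X :=
      IsLimit.conePointUniqueUpToIso (prodIsProd _ _)
        ((IsLimit.postcomposeHomEquiv (diagramIsoPair p.diag) _).2 p.isLimit)
    exact t.heart.prop_of_iso e
      ⟨(t.isLE₂ _ hT 0 ⟨hl.1⟩ ⟨hr.1⟩).le, (t.isGE₂ _ hT 0 ⟨hl.2⟩ ⟨hr.2⟩).ge⟩

lemma isLE_of_isZero {X : C} (hX : IsZero X) (n : ℤ) : t.IsLE X n :=
  (t.isLE_iff_orthogonal n (n + 1) rfl X).2 fun _ _ _ ↦ hX.eq_of_src _ _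

lemma isGE_of_isZero {X : C} (hX : IsZero X) (n : ℤ) : t.IsGE X n :=
  (t.isGE_iff_orthogonal (n - 1) n (by lia) X).2 fun _ _ _ ↦ hX.eq_of_tgt _ _

instance : t.heart.ContainsZero where
  exists_zero := ⟨0, isZero_zero C, (isLE_of_isZero t (isZero_zero C) 0).le,
    (isGE_of_isZero t (isZero_zero C) 0).ge⟩

instance : t.heart.IsClosedUnderFiniteProducts := .mk'

variable [IsTriangulated C]

/-- The heart of a t-structure is abelian. -/
@[reducible] noncomputable def heartAbelian : Abelian t.heart.FullSubcategory :=
  AbelianSubcategory.abelian t.heart.ι (heart_hom_shift_eq_zero t) (heart_admissibleMorphism t)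

lemma isAbelianCategory_heart : IsAbelianCategory t.heart.FullSubcategory := ⟨heartAbelian t, rfl⟩

end Heart

lemma IsAbelianCategory.of_equivalence {A B : Type*} [Category* A] [Category* B] [Preadditive A]
    [Preadditive B] (hA : IsAbelianCategory A) (F : A ⥤ B) [F.IsEquivalence] [F.Additive] :
    IsAbelianCategory B := by
  obtain ⟨hA, rfl⟩ := hA
  have : HasFiniteProducts B := ⟨fun n ↦ Adjunction.hasLimitsOfShape_of_equivalence F.inv⟩
  exact ⟨abelianOfEquivalence F.inv, rfl⟩

/-! ### Heart, boundedness and the restricted Yoneda functors. -/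

section Consequences

variable {S : Type u} [Category.{v} S] [Preadditive S] [HasZeroObject S] [HasShift S ℤ]
  [∀ n : ℤ, (shiftFunctor S n).Additive] [Pretriangulated S]

namespace GoodMetric

variable {𝓜 : GoodMetric S} {t : TStructure S}

instance (R : ObjectProperty S)
    (h : ∀ X : R.FullSubcategory, 𝓜.completionOf R ((yon S).obj X.obj)) :
    (𝓜.yonRestrict R h).Additive where
  map_add {_ _ f g} :=
    (𝓜.completionOf R).ι.map_injective ((yon S).map_add (f := f.hom) (g := g.hom))

instance (R : ObjectProperty S)
    (h : ∀ X : R.FullSubcategory, 𝓜.completionOf R ((yon S).obj X.obj)) :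
    (𝓜.yonRestrict R h).Full := by
  unfold yonRestrict
  infer_instance

instance (R : ObjectProperty S)
    (h : ∀ X : R.FullSubcategory, 𝓜.completionOf R ((yon S).obj X.obj)) :
    (𝓜.yonRestrict R h).Faithful := by
  unfold yonRestrict
  infer_instance

variable [IsTriangulated S]

lemma IsExtendable.isEquivalence_yonRestrict (ht : 𝓜.IsExtendable t) {R : ObjectProperty S} {n : ℤ}
    (hR : R ≤ t.ge n) (h : ∀ X : R.FullSubcategory, 𝓜.completionOf R ((yon S).obj X.obj)) :
    (𝓜.yonRestrict R h).IsEquivalence where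
  essSurj := ⟨fun F ↦ by
    obtain ⟨X, hX, ⟨e⟩⟩ := ht.exists_yon_iso hR F.property
    exact ⟨⟨X, hX⟩, ⟨ObjectProperty.isoMk _ e⟩⟩⟩

lemma IsExtendable.map_heart (ht : 𝓜.IsExtendable t) :
    (𝓜.inCompletion (t.le 0) ⊓ 𝓜.inCompletion (t.ge 0)).map 𝓜.inclusion =
      t.heart.map (yon S) := by
  ext F
  constructor
  · rintro ⟨G, ⟨hl, hg⟩, ⟨e⟩⟩
    obtain ⟨X, hX, ⟨e'⟩⟩ := ht.exists_yon_iso le_rfl hg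
    have hl' : 𝓜.completionOf (t.le 0) ((yon S).obj X) :=
      (𝓜.completionOf (t.le 0)).prop_of_iso e'.symm hl
    refine ⟨X, ⟨?_, hX⟩, ⟨e' ≪≫ e⟩⟩
    -- The aisle of `S` is detected by orthogonality to `t.ge 1`, and full faithfulness carries this
    -- orthogonality back from the completion.
    refine ((t.isLE_iff_orthogonal 0 1 (by lia) X).2 fun Y f hY ↦ ?_).le
    refine (yon S).map_injective ?_
    rw [Functor.map_zero]
    exact ht.hom_eq_zero hl' (ht.completionOf_yon hY.ge hY.ge) _
  · rintro ⟨X, hX, ⟨e⟩⟩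
    exact ⟨⟨_, ht.completionOf_yon trivial hX.2⟩,
      ⟨ht.completionOf_yon hX.1 hX.2, ht.completionOf_yon hX.2 hX.2⟩, ⟨e⟩⟩

lemma IsExtendable.exists_inCompletion_le (ht : 𝓜.IsExtendable t) (h : t.minus = ⊤)
    (F : 𝓜.Completion) : ∃ n : ℤ, 𝓜.inCompletion (t.le n) F := by
  obtain ⟨X, hX, -, ι, hι⟩ := exists_isIndLimit_of_completionOf F.property
  obtain ⟨k, hk⟩ := ht
  obtain ⟨N, hN⟩ := hX.exists_trW 𝓜 k
  obtain ⟨n, hn⟩ : t.minus (X.obj N) := by rw [h]; trivial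
  obtain ⟨i, hi⟩ := GoodMetric.exists_isTest F.property
  let φ : ℕ ⥤ ℕ := (show Monotone fun n ↦ N + n from fun _ _ h ↦ by dsimp; lia).functor
  have hφ (n : ℕ) : n ≤ φ.obj n := Nat.le_add_left n N
  -- A late term is an extension of a cone in `t.le 0` by `X N` in `t.le n`, so one bound serves for
  -- the whole tail.
  refine ⟨max n 0, completionOf_of_isIndLimit (hX.reindex 𝓜 φ hφ) (fun m ↦ ?_)
    (hι.reindex φ hφ) hi.2⟩
  have hm : N ≤ φ.obj m := Nat.le_add_right N m
  obtain ⟨C, c, c', hT, hC⟩ := hN N (φ.obj m) (homOfLE hm) le_rfl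
  have hC' : t.IsLE C 0 := ⟨hk C hC⟩
  exact (t.isLE₂ _ hT (max n 0) (t.isLE_of_le (X.obj N) n _ (le_max_left _ _))
    (t.isLE_of_le C 0 _ (le_max_right _ _))).le

/-- The image of a distinguished triangle under the Yoneda functor is the colimit of a constant
sequence. -/
lemma nonempty_indTriangle_mapTriangle {T : Triangle S} (hT : T ∈ distTriang S) :
    Nonempty (𝓜.IndTriangle ((yon S).mapTriangle.obj T)) :=
  ⟨IndTriangle.ofFunctor ((Functor.const ℕ).obj T) (fun _ ↦ hT) (𝓜.isCauchy_const T.obj₁)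
    (𝓜.isCauchy_const T.obj₂) (𝓜.isCauchy_const T.obj₃) (fun _ ↦ 𝟙 _) (IsIndLimit.const T.obj₁)
    (IsIndLimit.const T.obj₂) (IsIndLimit.const T.obj₃)⟩

lemma isTriangulated_yonLift (h : ∀ X : S, 𝓜.completionOf ⊤ ((yon S).obj X)) :
    letI := 𝓜.pretriangulated
    (𝓜.yonLift h).IsTriangulated :=
  letI := 𝓜.pretriangulated
  { map_distinguished := fun T hT ↦ (mem_completionTriangles_iff _).2
      ⟨(nonempty_indTriangle_mapTriangle hT).some.ofIso
        ((Functor.mapTriangleIso ((𝓜.completionOf ⊤).liftCompιIso (yon S) h)).symm.app T ≪≫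
          (Functor.mapTriangleCompIso (𝓜.yonLift h) 𝓜.inclusion).app T)⟩ }

lemma IsExtendable.map_yonLift_ge (ht : 𝓜.IsExtendable t)
    (h : ∀ X : S, 𝓜.completionOf ⊤ ((yon S).obj X)) (n : ℤ) :
    (t.ge n).map (𝓜.yonLift h) = 𝓜.inCompletion (t.ge n) := by
  ext F
  constructor
  · rintro ⟨X, hX, ⟨e⟩⟩
    exact (𝓜.completionOf (t.ge n)).prop_of_iso (𝓜.inclusion.mapIso e) (ht.completionOf_yon hX hX)
  · intro hF
    obtain ⟨X, hX, ⟨e⟩⟩ := ht.exists_yon_iso le_rfl hF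
    exact ⟨X, hX, ⟨ObjectProperty.isoMk _ e⟩⟩

end GoodMetric

end Consequences

end MetricCompletion

theorem theorem3p5 {S : Type u} [Category.{v} S] [Preadditive S] [HasZeroObject S] [HasShift S ℤ]
    [∀ n : ℤ, (shiftFunctor S n).Additive] [Pretriangulated S] [IsTriangulated S]
    [EssentiallySmall.{v} S] (𝓜 : MetricCompletion.GoodMetric S) (t : TStructure S)
    (ht : 𝓜.IsExtendable t) :
    -- the completion, with the given shift and triangles, is a triangulated category
    ∃ (hP : Pretriangulated 𝓜.Completion) (_ : IsTriangulated 𝓜.Completion)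
      (t' : TStructure 𝓜.Completion),
      hP.distinguishedTriangles = 𝓜.completionTriangles ∧
      -- the t-structure on the completion, and its heart
      (t'.le 0 = 𝓜.inCompletion (t.le 0) ∧ t'.ge 0 = 𝓜.inCompletion (t.ge 0) ∧
        t'.heart.map (𝓜.completionOf ⊤).ι = t.heart.map (MetricCompletion.yon S)) ∧
      -- the Yoneda functor on subcategories of the coaisle
      (∀ R : ObjectProperty S, R ≤ t.ge 0 →
        ∃ h : ∀ X : R.FullSubcategory, 𝓜.completionOf R ((MetricCompletion.yon S).obj X.obj),
          (𝓜.yonRestrict R h).IsEquivalence ∧ (𝓜.yonRestrict R h).Additive) ∧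
      -- the Yoneda functor on the heart
      (MetricCompletion.IsAbelianCategory t.heart.FullSubcategory ∧
        MetricCompletion.IsAbelianCategory (𝓜.completionOf t.heart).FullSubcategory ∧
        ∃ h : ∀ X : t.heart.FullSubcategory,
            𝓜.completionOf t.heart ((MetricCompletion.yon S).obj X.obj),
          (𝓜.yonRestrict t.heart h).IsEquivalence ∧ (𝓜.yonRestrict t.heart h).Additive ∧
          PreservesFiniteLimits (𝓜.yonRestrict t.heart h) ∧
          PreservesFiniteColimits (𝓜.yonRestrict t.heart h)) ∧
      -- boundedness above
      (t.minus = ⊤ → t'.minus = ⊤) ∧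
      -- boundedness below
      (t.plus = ⊤ →
        ∃ h : ∀ X : S, 𝓜.completionOf ⊤ ((MetricCompletion.yon S).obj X),
          (𝓜.yonLift h).Full ∧ (𝓜.yonLift h).Faithful ∧ (𝓜.yonLift h).IsTriangulated ∧
          t.le 0 ≤ (t'.le 0).inverseImage (𝓜.yonLift h) ∧
          (t.ge 0).map (𝓜.yonLift h) = t'.ge 0) := by
  have hheart : t.heart ≤ t.ge 0 := fun X hX ↦ hX.2
  have h₀ (X : t.heart.FullSubcategory) :
      𝓜.completionOf t.heart ((MetricCompletion.yon S).obj X.obj) :=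
    ht.completionOf_yon X.property (hheart _ X.property)
  have := ht.isEquivalence_yonRestrict hheart h₀
  have hab := MetricCompletion.isAbelianCategory_heart t
  refine ⟨𝓜.pretriangulated, 𝓜.isTriangulated, ht.tStructure, rfl, ⟨rfl, rfl, ht.map_heart⟩,
    fun R hR ↦ ?_, ⟨hab, hab.of_equivalence (𝓜.yonRestrict t.heart h₀), h₀, inferInstance,
      inferInstance, inferInstance, inferInstance⟩, fun h ↦ ?_, fun h ↦ ?_⟩
  · have hR' (X : R.FullSubcategory) := ht.completionOf_yon X.property (hR _ X.property)
    exact ⟨hR', ht.isEquivalence_yonRestrict hR hR', inferInstance⟩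
  · let := 𝓜.pretriangulated
    ext F
    refine iff_of_true ?_ trivial
    obtain ⟨n, hn⟩ := ht.exists_inCompletion_le h F
    exact ⟨n, ⟨hn⟩⟩
  · have hplus (X : S) : ∃ n : ℤ, t.ge n X := by
      obtain ⟨n, hn⟩ : t.plus X := by rw [h]; trivial
      exact ⟨n, hn.ge⟩
    have hX (X : S) : 𝓜.completionOf ⊤ ((MetricCompletion.yon S).obj X) :=
      ht.completionOf_yon trivial (hplus X).choose_spec
    exact ⟨hX, inferInstance, inferInstance, MetricCompletion.GoodMetric.isTriangulated_yonLift hX,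
      fun X hX ↦ ht.completionOf_yon hX (hplus X).choose_spec, ht.map_yonLift_ge hX 0⟩
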